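/- Let $\mathcal H$ be a complex Hilbert space and let $\mathcal A\subseteq\mathcal B(\mathcal H)$ be a von Neumann algebra that is a type $II_\infty$ factor: $\mathcal A\cap\mathcal A'=\mathbb C\cdot 1$, $\mathcal A$ contains no minimal projection, and $\mathcal A$ contains a nonzero finite projection and an infinite projection. Here projections $P,Q\in\mathcal A$ are (Murray–von Neumann) equivalent, $P\sim Q$, if $V^*V=P$ and $VV^*=Q$ for some $V\in\mathcal A$; a projection $P\in\mathcal A$ is finite if no projection $Q\in\mathcal A$ with $Q\le P$, $Q\ne P$ satisfies $Q\sim P$, and infinite otherwise; a nonzero projection is minimal if its only subprojections in $\mathcal A$ are $0$ and itself. Then $\mathcal A$ contains nonzero finite projections, and for every nonzero finite projection $P_0\in\mathcal A$ the following hold. (i) There is an infinite family $(P_i)_{i\in I}$ of mutually orthogonal finite projections in $\mathcal A$, having $P_0$ as a member, with $P_i\sim P_0$ for all $i\in I$ and $\sum_{i\in I}P_i=1$ (strong operator topology). If $\mathcal H$ is separable, $I$ is countable. (ii) Let $(P_i)_{i\in I}$ be any family of mutually orthogonal finite projections in $\mathcal A$ with $P_i\sim P_0$ for all $i$ and $\sum_{i\in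 I} P_i=1$, let $V_i\in\mathcal A$ satisfy $V_i^*V_i=P_0$ and $V_iV_i^*=P_i$, and let $\mathcal H_I$ be a Hilbert space with an orthonormal basis $(\psi_i)_{i\in I}$. Then there is a unitary $U:\mathcal H\to P_0\mathcal H\otimes\mathcal H_I$ with $U(V_ix)=x\otimes\psi_i$ for all $x\in P_0\mathcal H$ and $i\in I$, such that $$U\mathcal A U^{-1}=P_0\mathcal A P_0\,\overline{\otimes}\,\mathcal B(\mathcal H_I),$$ where $P_0\mathcal AP_0$ acts on $P_0\mathcal H$ and $\overline\otimes$ denotes the von Neumann tensor product (the double commutant of the algebraic tensor product). Moreover, for every $T\in\mathcal A$, $$UTU^{-1}=\sum_{k,i\in I}(V_k^*TV_i)\otimes W_{ki},$$ where $W_{ki}\in\mathcal B(\mathcal H_I)$ is the matrix unit $W_{ki}\,y=\langle\psi_i,y\rangle\,\psi_k$. The sum converges in the strong operator topology as the limit of the rectangular partial sums $\sum_{k\in F}\sum_{i\in G}$ over finite subsets $F,G\subseteq I$, both increasing to $I$. -/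

import Mathlib

open scoped TensorProduct

universe u v w

noncomputable section

namespace VNA

/-! ### Projections in a von Neumann algebra and type II_∞ factors -/

section Types

variable {H : Type u} [NormedAddCommGroup H] [InnerProductSpace ℂ H] [CompleteSpace H]

/-- `P` is a projection (self-adjoint idempotent) belonging to `A`. -/
structure IsProj (A : VonNeumannAlgebra H) (P : H →L[ℂ] H) : Prop where
  mem : P ∈ A
  isStarProjection : IsStarProjection P

/-- Murray–von Neumann equivalence `P ∼ Q` in `A`: some `V ∈ A` has `V* V = P` and `V V* = Q`. -/
def MvNEquiv (A : VonNeumannAlgebra H) (P Q : H →L[ℂ] H) : Prop :=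
  ∃ V ∈ A, star V * V = P ∧ V * star V = Q

/-- `Q` is a projection of `A` with `Q ≤ P` (for projections, `Q ≤ P` iff `P Q = Q`). -/
structure IsSubproj (A : VonNeumannAlgebra H) (Q P : H →L[ℂ] H) : Prop where
  isProj : IsProj A Q
  mul_eq : P * Q = Q

/-- A projection of `A` is finite if no proper subprojection in `A` is equivalent to it. -/
structure IsFiniteProj (A : VonNeumannAlgebra H) (P : H →L[ℂ] H) : Prop where
  isProj : IsProj A P
  eq_of_equiv : ∀ Q, IsSubproj A Q P → MvNEquiv A Q P → Q = P

/-- A projection of `A` is infinite if some proper subprojection in `A` is equivalent to it. -/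
structure IsInfiniteProj (A : VonNeumannAlgebra H) (P : H →L[ℂ] H) : Prop where
  isProj : IsProj A P
  exists_equiv : ∃ Q, IsSubproj A Q P ∧ Q ≠ P ∧ MvNEquiv A Q P

/-- A nonzero projection of `A` is minimal if its only subprojections in `A` are `0` and itself. -/
structure IsMinimalProj (A : VonNeumannAlgebra H) (P : H →L[ℂ] H) : Prop where
  isProj : IsProj A P
  ne_zero : P ≠ 0
  eq_or_eq : ∀ Q, IsSubproj A Q P → Q = 0 ∨ Q = P

/-- A factor: the centre `A ∩ A'` consists of the multiples of the identity. -/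
def IsFactor (A : VonNeumannAlgebra H) : Prop :=
  ∀ T ∈ A, T ∈ A.commutant → ∃ c : ℂ, T = c • (1 : H →L[ℂ] H)

/-- A type II_∞ factor: no minimal projections, but a (nonzero) finite projection and an
infinite projection. -/
structure IsTypeIIInftyFactor (A : VonNeumannAlgebra H) : Prop where
  isFactor : IsFactor A
  no_minimal : ∀ P, ¬ IsMinimalProj A P
  exists_finite : ∃ P, IsFiniteProj A P ∧ P ≠ 0
  exists_infinite : ∃ P, IsInfiniteProj A P

/-- `P` is a family of mutually orthogonal finite projections of `A`, all equivalent to `P₀` in `A`,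
with `∑ i, P i = 1` in the strong operator topology. -/
structure IsFiniteDecomposition (A : VonNeumannAlgebra H) (P₀ : H →L[ℂ] H) {I : Type v}
    (P : I → H →L[ℂ] H) : Prop where
  finite : ∀ i, IsFiniteProj A (P i)
  orthogonal : ∀ i j, i ≠ j → P i * P j = 0
  equiv : ∀ i, MvNEquiv A P₀ (P i)
  hasSum : ∀ x : H, HasSum (fun i => P i x) x

end Types

/-! ### The reduced algebra `P A P` on the Hilbert space `P H` -/

section Corner

variable {H : Type u} [NormedAddCommGroup H] [InnerProductSpace ℂ H]

/-- The Hilbert space `P H` for a projection `P`, as the closed subspace of the vectors fixed by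
`P`. -/
def projSpace (P : H →L[ℂ] H) : Submodule ℂ H := (1 - P).ker

theorem mem_projSpace {P : H →L[ℂ] H} {x : H} : x ∈ projSpace P ↔ P x = x := by
  change x - P x = 0 ↔ P x = x
  rw [sub_eq_zero, eq_comm]

variable [CompleteSpace H]

theorem projSpace_eq_range {P : H →L[ℂ] H} (hP : IsStarProjection P) :
    projSpace P = P.range := by
  ext x
  rw [mem_projSpace]
  constructor
  · exact fun h => ⟨x, h⟩
  · rintro ⟨y, rfl⟩
    exact congrArg (fun T : H →L[ℂ] H => T y) hP.isIdempotentElem.eq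

instance (P : H →L[ℂ] H) : CompleteSpace (projSpace P) :=
  inferInstanceAs (CompleteSpace (1 - P).ker)

/-- The operator on `P H` induced by `P T P`. -/
def compress (P T : H →L[ℂ] H) : projSpace P →L[ℂ] projSpace P :=
  (projSpace P).orthogonalProjectionOnto ∘L T ∘L (projSpace P).subtypeL

theorem coe_orthogonalProjectionOnto {P : H →L[ℂ] H} (hP : IsStarProjection P) (x : H) :
    ((projSpace P).orthogonalProjectionOnto x : H) = P x := by
  have hPP : ∀ y, P (P y) = P y := fun y =>
    congrArg (fun T : H →L[ℂ] H => T y) hP.isIdempotentElem.eq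
  have hsa : P.adjoint = P := hP.isSelfAdjoint
  refine Submodule.eq_starProjection_of_mem_of_inner_eq_zero (mem_projSpace.2 (hPP x)) ?_
  intro w hw
  rw [← mem_projSpace.1 hw]
  have : inner ℂ (x - P x) (P w) = inner ℂ (P (x - P x)) w := by
    rw [← ContinuousLinearMap.adjoint_inner_left, hsa]
  rw [this, map_sub, hPP, sub_self, inner_zero_left]

theorem coe_compress_apply {P : H →L[ℂ] H} (hP : IsStarProjection P) (T : H →L[ℂ] H)
    (x : projSpace P) : (compress P T x : H) = P (T x) :=
  coe_orthogonalProjectionOnto hP (T x)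

theorem compress_mul {P : H →L[ℂ] H} (hP : IsStarProjection P) (S T : H →L[ℂ] H) :
    compress P S * compress P T = compress P (S * P * T) := by
  ext x
  simp [coe_compress_apply hP]

theorem star_compress (P T : H →L[ℂ] H) : star (compress P T) = compress P (star T) := by
  rw [ContinuousLinearMap.star_eq_adjoint, ContinuousLinearMap.star_eq_adjoint, compress, compress,
    ContinuousLinearMap.adjoint_comp, ContinuousLinearMap.adjoint_comp,
    Submodule.adjoint_subtypeL, Submodule.adjoint_orthogonalProjectionOnto,
    ContinuousLinearMap.comp_assoc]

theorem compress_add (P S T : H →L[ℂ] H) :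
    compress P (S + T) = compress P S + compress P T := by
  ext x
  simp [compress]

theorem compress_algebraMap {P : H →L[ℂ] H} (hP : IsStarProjection P) (c : ℂ) :
    compress P (algebraMap ℂ (H →L[ℂ] H) c) = algebraMap ℂ _ c := by
  ext x
  rw [coe_compress_apply hP, Algebra.algebraMap_eq_smul_one, Algebra.algebraMap_eq_smul_one]
  simp [mem_projSpace.1 x.2]

/-- The reduced von Neumann algebra `P A P`, acting on the Hilbert space `P H`. -/
def corner (A : VonNeumannAlgebra H) (P : H →L[ℂ] H) (hP : IsProj A P) :
    VonNeumannAlgebra (projSpace P) where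
  carrier := {a | ∃ T ∈ A, a = compress P T}
  mul_mem' := by
    rintro _ _ ⟨S, hS, rfl⟩ ⟨T, hT, rfl⟩
    exact ⟨S * P * T, mul_mem (mul_mem hS hP.mem) hT, compress_mul hP.isStarProjection S T⟩
  add_mem' := by
    rintro _ _ ⟨S, hS, rfl⟩ ⟨T, hT, rfl⟩
    exact ⟨S + T, add_mem hS hT, (compress_add P S T).symm⟩
  algebraMap_mem' := fun c =>
    ⟨algebraMap ℂ _ c, A.toStarSubalgebra.algebraMap_mem c,
      (compress_algebraMap hP.isStarProjection c).symm⟩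
  star_mem' := by
    rintro _ ⟨T, hT, rfl⟩
    exact ⟨star T, star_mem hT, star_compress P T⟩
  centralizer_centralizer' := by
    have hs := hP.isStarProjection
    refine Set.Subset.antisymm ?_ Set.subset_centralizer_centralizer
    intro a ha
    have key : (projSpace P).subtypeL ∘L a ∘L (projSpace P).orthogonalProjectionOnto ∈ A := by
      rw [← A.commutant_commutant, VonNeumannAlgebra.mem_commutant_iff]
      intro y hy
      rw [VonNeumannAlgebra.mem_commutant_iff] at hy
      have hyP : ∀ z, P (y z) = y (P z) := fun z =>
        congrArg (fun T : H →L[ℂ] H => T z) (hy P hP.mem)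
      have hc : compress P y ∈ Set.centralizer {a | ∃ T ∈ A, a = compress P T} := by
        rw [Set.mem_centralizer_iff]
        rintro _ ⟨T, hT, rfl⟩
        rw [compress_mul hs, compress_mul hs]
        rw [hy _ (mul_mem hT hP.mem), mul_assoc y, ← hy (P * T) (mul_mem hP.mem hT)]
        ext x
        have hx : P x = x := mem_projSpace.1 x.2
        have hPP : ∀ z, P (P z) = P z := fun z =>
          congrArg (fun T : H →L[ℂ] H => T z) hs.isIdempotentElem.eq
        have hyT : ∀ z, T (y z) = y (T z) := fun z =>
          congrArg (fun T : H →L[ℂ] H => T z) (hy T hT)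
        simp [coe_compress_apply hs, hx, hPP, hyP, hyT]
      have hcomm := Set.mem_centralizer_iff.1 ha _ hc
      ext x
      have h1 : (projSpace P).orthogonalProjectionOnto (y x) =
          compress P y ((projSpace P).orthogonalProjectionOnto x) := by
        apply Subtype.ext
        have hPP : P (P x) = P x :=
          congrArg (fun T : H →L[ℂ] H => T x) hs.isIdempotentElem.eq
        rw [coe_compress_apply hs, coe_orthogonalProjectionOnto hs,
          coe_orthogonalProjectionOnto hs, hyP, hyP, hPP]
      have h2 : compress P y (a ((projSpace P).orthogonalProjectionOnto x)) =
          a (compress P y ((projSpace P).orthogonalProjectionOnto x)) :=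
        congrArg (fun T : projSpace P →L[ℂ] projSpace P =>
          T ((projSpace P).orthogonalProjectionOnto x)) hcomm
      change y (a ((projSpace P).orthogonalProjectionOnto x) : H) =
        (a ((projSpace P).orthogonalProjectionOnto (y x)) : H)
      rw [h1, ← h2, coe_compress_apply hs, hyP, mem_projSpace.1 (Subtype.prop _)]
    refine ⟨_, key, ?_⟩
    ext x
    rw [coe_compress_apply hs]
    have h3 : (projSpace P).orthogonalProjectionOnto (x : H) = x := by
      apply Subtype.ext
      rw [coe_orthogonalProjectionOnto hs, mem_projSpace.1 x.2]
    change (a x : H) = P (a ((projSpace P).orthogonalProjectionOnto (x : H)) : H)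
    rw [h3, mem_projSpace.1 (Subtype.prop _)]

theorem mem_corner {A : VonNeumannAlgebra H} {P : H →L[ℂ] H} (hP : IsProj A P)
    {a : projSpace P →L[ℂ] projSpace P} : a ∈ corner A P hP ↔ ∃ T ∈ A, a = compress P T :=
  Iff.rfl

end Corner

/-! ### Tensor products of Hilbert spaces and of von Neumann algebras -/

section Tensor

variable {H : Type u} [NormedAddCommGroup H] [InnerProductSpace ℂ H]
  {K : Type v} [NormedAddCommGroup K] [InnerProductSpace ℂ K]

/-- The Hilbert space tensor product: the completion of the algebraic tensor product for
`⟪x ⊗ y, x' ⊗ y'⟫ = ⟪x, x'⟫ ⟪y, y'⟫`. -/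
abbrev HilbertTensor (H : Type u) [NormedAddCommGroup H] [InnerProductSpace ℂ H]
    (K : Type v) [NormedAddCommGroup K] [InnerProductSpace ℂ K] : Type (max u v) :=
  UniformSpace.Completion (H ⊗[ℂ] K)

/-- The elementary tensor `x ⊗ y` in the Hilbert space tensor product. -/
def htmul (x : H) (y : K) : HilbertTensor H K := ((x ⊗ₜ[ℂ] y : H ⊗[ℂ] K) : HilbertTensor H K)

/-- The tensor product `a ⊗ b` of bounded operators, the bounded operator on the Hilbert space
tensor product with `(a ⊗ b) (x ⊗ y) = a x ⊗ b y`. -/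
def opTensor (a : H →L[ℂ] H) (b : K →L[ℂ] K) : HilbertTensor H K →L[ℂ] HilbertTensor H K :=
  (TensorProduct.mapL a b).completion

theorem opTensor_htmul (a : H →L[ℂ] H) (b : K →L[ℂ] K) (x : H) (y : K) :
    opTensor a b (htmul x y) = htmul (a x) (b y) := by
  rw [opTensor, htmul, ContinuousLinearMap.completion_apply_coe, TensorProduct.mapL_tmul, htmul]

theorem star_opTensor [CompleteSpace H] [CompleteSpace K] (a : H →L[ℂ] H) (b : K →L[ℂ] K) :
    star (opTensor a b) = opTensor (star a) (star b) := by
  rw [ContinuousLinearMap.star_eq_adjoint, eq_comm, ContinuousLinearMap.eq_adjoint_iff]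
  intro x y
  induction x, y using UniformSpace.Completion.induction_on₂ with
  | hp => exact isClosed_eq (by fun_prop) (by fun_prop)
  | ih x y =>
    simp only [opTensor, ContinuousLinearMap.completion_apply_coe,
      UniformSpace.Completion.inner_coe]
    induction x with
    | zero => simp
    | add x₁ x₂ h₁ h₂ => simp only [map_add, inner_add_left, h₁, h₂]
    | tmul x₁ x₂ =>
      induction y with
      | zero => simp
      | add y₁ y₂ h₁ h₂ => simp only [map_add, inner_add_right, h₁, h₂]
      | tmul y₁ y₂ =>
        simp [ContinuousLinearMap.star_eq_adjoint, ContinuousLinearMap.adjoint_inner_left]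

variable [CompleteSpace H] [CompleteSpace K]

/-- The von Neumann algebra tensor product: the double commutant of the operators `a ⊗ b` with
`a ∈ M` and `b ∈ N`. -/
def vnTensor (M : VonNeumannAlgebra H) (N : VonNeumannAlgebra K) :
    VonNeumannAlgebra (HilbertTensor H K) where
  toStarSubalgebra := StarSubalgebra.centralizer ℂ
    (Set.centralizer {T | ∃ a ∈ M, ∃ b ∈ N, T = opTensor a b})
  centralizer_centralizer' := by simp

theorem coe_vnTensor (M : VonNeumannAlgebra H) (N : VonNeumannAlgebra K) :
    (vnTensor M N : Set (HilbertTensor H K →L[ℂ] HilbertTensor H K)) =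
      Set.centralizer (Set.centralizer {T | ∃ a ∈ M, ∃ b ∈ N, T = opTensor a b}) := by
  set S : Set (HilbertTensor H K →L[ℂ] HilbertTensor H K) :=
    {T | ∃ a ∈ M, ∃ b ∈ N, T = opTensor a b} with hS
  have hstar : star S = S := by
    have h : ∀ T ∈ S, star T ∈ S := by
      rintro _ ⟨a, ha, b, hb, rfl⟩
      exact ⟨star a, star_mem ha, star b, star_mem hb, star_opTensor a b⟩
    ext T
    exact ⟨fun hT => star_star T ▸ h _ hT, fun hT => h _ hT⟩
  have hc : star (Set.centralizer S) = Set.centralizer S := by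
    have h : ∀ T ∈ Set.centralizer S, star T ∈ Set.centralizer S := fun T hT =>
      Set.star_mem_centralizer' (fun a ha => by rw [← hstar]; simpa using ha) hT
    ext T
    exact ⟨fun hT => star_star T ▸ h _ hT, fun hT => h _ hT⟩
  change Set.centralizer (Set.centralizer S ∪ star (Set.centralizer S)) = _
  rw [hc, Set.union_self]

/-- The von Neumann algebra `B(K)` of all bounded operators. -/
def boundedOps (K : Type v) [NormedAddCommGroup K] [InnerProductSpace ℂ K] [CompleteSpace K] :
    VonNeumannAlgebra K where
  toStarSubalgebra := ⊤
  centralizer_centralizer' :=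
    Set.Subset.antisymm (Set.subset_univ _) Set.subset_centralizer_centralizer

/-- The matrix unit `W_{ki}` of `B(K)` for an orthonormal basis `ψ`: the operator
`y ↦ ⟪ψ i, y⟫ ψ k`, mapping `ψ i` to `ψ k` and vanishing on the other basis vectors. -/
def matrixUnit {I : Type*} (ψ : HilbertBasis I ℂ K) (k i : I) : K →L[ℂ] K :=
  (innerSL ℂ (ψ i)).smulRight (ψ k)

end Tensor

end VNA

end

/-! Existence of the decomposition rests on comparison. In a factor, the vectors x with QAx = 0 form
a closed subspace invariant under A and A', so its projection is a scalar; hence QAP ≠ 0 for nonzero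
P and Q, and the polar part of a nonzero QTP links a part of P with a part of Q. Exhausting P and Q
by such partial isometries gives `IsFactor.comparison`. A maximal family of orthogonal copies P_j of
P₀, all orthogonal to P₀, therefore leaves a remainder R equivalent to some R' ≤ P₀. The family is
infinite: otherwise 1 would be a finite sum of orthogonal finite projections, hence finite
(`IsFactor.isFiniteProj_add`, via Kaplansky's parallelogram law), while 1 dominates an infinite
projection. The remainder is absorbed as in Hilbert's hotel: each P_j splits into a copy of R' and a
copy of P₀ - R', and the copies of R', with R added to them, are redistributed over the same
indices.

For the spatial statement, H and P₀H ⊗ K are both Hilbert sums of I copies of P₀H, through the V_i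
and through x ↦ x ⊗ ψ_i; matching the summands defines U. It carries the block P_k T P_i to (V_k* T
V_i) ⊗ W_ki, so U T U⁻¹ is the strong limit of its rectangular truncations. For T in A these lie in
the algebraic tensor product, which gives one inclusion. Conversely, U carries y in A' to its
restriction to P₀H tensored with 1, which commutes with P₀AP₀ ⊗ B(K). Hence whatever lies in the
double commutant pulls back to an operator commuting with A', that is, to an element of A. -/

namespace VNA

/-! ### Partial isometries, Murray–von Neumann equivalence and finiteness. -/

section PartialIsometry

variable {H : Type u} [NormedAddCommGroup H] [InnerProductSpace ℂ H] [CompleteSpace H]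

/-- By the C*-identity it suffices that (VP - V)*(VP - V) = 0 for P = V*V, and this expands into
powers of P that cancel. -/
theorem mul_initial {V : H →L[ℂ] H} (h : IsStarProjection (star V * V)) :
    V * (star V * V) = V := by
  have hi : star V * V * (star V * V) = star V * V := h.isIdempotentElem.eq
  rw [← sub_eq_zero, ← CStarRing.star_mul_self_eq_zero_iff]
  have : star (V * (star V * V) - V) * (V * (star V * V) - V) =
      star V * V * (star V * V) * (star V * V) - star V * V * (star V * V)
        - (star V * V * (star V * V) - star V * V) := by
    simp only [star_sub, star_mul, star_star]
    noncomm_ring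
  rw [this, hi, hi, sub_self]

theorem isStarProjection_final {V : H →L[ℂ] H} (h : IsStarProjection (star V * V)) :
    IsStarProjection (V * star V) := by
  refine ⟨?_, by simp [isSelfAdjoint_iff]⟩
  rw [IsIdempotentElem]
  calc V * star V * (V * star V) = V * (star V * V) * star V := by noncomm_ring
    _ = _ := by rw [mul_initial h]

theorem isStarProjection_initial {V : H →L[ℂ] H} (h : IsStarProjection (V * star V)) :
    IsStarProjection (star V * V) := by
  have := isStarProjection_final (V := star V) (by simpa using h)
  simpa using this

theorem final_mul {V : H →L[ℂ] H} (h : IsStarProjection (V * star V)) :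
    V * star V * V = V := by
  rw [mul_assoc, mul_initial (isStarProjection_initial h)]

variable {A : VonNeumannAlgebra H}

theorem isProj_zero : IsProj A 0 := ⟨zero_mem A, .zero _⟩

theorem isProj_one : IsProj A 1 := ⟨one_mem A, .one _⟩

theorem IsProj.star_eq {P : H →L[ℂ] H} (h : IsProj A P) : star P = P :=
  h.isStarProjection.isSelfAdjoint

theorem IsProj.mul_self {P : H →L[ℂ] H} (h : IsProj A P) : P * P = P :=
  h.isStarProjection.isIdempotentElem.eq

theorem IsProj.apply_apply {P : H →L[ℂ] H} (h : IsProj A P) (x : H) : P (P x) = P x :=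
  congr($(h.mul_self) x)

theorem IsProj.mul_comm_eq {P Q : H →L[ℂ] H} (hP : IsProj A P) (hQ : IsProj A Q)
    (h : P * Q = Q) : Q * P = Q := by
  have := congr(star $h)
  rwa [star_mul, hP.star_eq, hQ.star_eq] at this

theorem IsProj.mul_comm_zero {P Q : H →L[ℂ] H} (hP : IsProj A P) (hQ : IsProj A Q)
    (h : P * Q = 0) : Q * P = 0 := by
  have := congr(star $h)
  rwa [star_mul, hP.star_eq, hQ.star_eq, star_zero] at this

theorem IsSubproj.mul_eq' {P Q : H →L[ℂ] H} (h : IsSubproj A Q P) (hP : IsProj A P) :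
    Q * P = Q := hP.mul_comm_eq h.isProj h.mul_eq

theorem IsSubproj.trans {P Q R : H →L[ℂ] H} (h : IsSubproj A R Q) (h' : IsSubproj A Q P) :
    IsSubproj A R P :=
  ⟨h.isProj, by rw [← h.mul_eq, ← mul_assoc, h'.mul_eq]⟩

theorem IsProj.add {P Q : H →L[ℂ] H} (hP : IsProj A P) (hQ : IsProj A Q) (h : P * Q = 0) :
    IsProj A (P + Q) := by
  refine ⟨add_mem hP.mem hQ.mem, ?_, ?_⟩
  · simp [IsIdempotentElem, add_mul, mul_add, hP.mul_self, hQ.mul_self, h, hP.mul_comm_zero hQ h]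
  · simp [isSelfAdjoint_iff, hP.star_eq, hQ.star_eq]

theorem IsSubproj.sub {P Q : H →L[ℂ] H} (h : IsSubproj A Q P) (hP : IsProj A P) :
    IsProj A (P - Q) := by
  refine ⟨sub_mem hP.mem h.isProj.mem, ?_, ?_⟩
  · simp [IsIdempotentElem, sub_mul, mul_sub, hP.mul_self, h.isProj.mul_self, h.mul_eq,
      h.mul_eq' hP]
  · simp [isSelfAdjoint_iff, hP.star_eq, h.isProj.star_eq]

theorem IsSubproj.sub_subproj {P Q : H →L[ℂ] H} (h : IsSubproj A Q P) (hP : IsProj A P) :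
    IsSubproj A (P - Q) P :=
  ⟨h.sub hP, by rw [mul_sub, hP.mul_self, h.mul_eq]⟩

theorem IsSubproj.mul_sub_eq_zero {P Q : H →L[ℂ] H} (h : IsSubproj A Q P) (hP : IsProj A P) :
    Q * (P - Q) = 0 := by
  rw [mul_sub, h.isProj.mul_self, h.mul_eq' hP, sub_self]

/-- Projections with the same fixed vectors are equal. -/
theorem IsProj.ext {P Q : H →L[ℂ] H} (hP : IsProj A P) (hQ : IsProj A Q)
    (h : ∀ x, P x = x ↔ Q x = x) : P = Q := by
  have h1 : P * Q = Q := by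
    ext x
    exact (h (Q x)).2 (hQ.apply_apply x)
  have h2 : Q * P = P := by
    ext x
    exact (h (P x)).1 (hP.apply_apply x)
  rw [← h1, hQ.mul_comm_eq hP h2]

theorem MvNEquiv.refl {P : H →L[ℂ] H} (hP : IsProj A P) : MvNEquiv A P P :=
  ⟨P, hP.mem, by rw [hP.star_eq, hP.mul_self], by rw [hP.star_eq, hP.mul_self]⟩

theorem MvNEquiv.symm {P Q : H →L[ℂ] H} (h : MvNEquiv A P Q) : MvNEquiv A Q P := by
  obtain ⟨V, hV, h1, h2⟩ := h
  exact ⟨star V, star_mem hV, by rwa [star_star], by rwa [star_star]⟩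

theorem MvNEquiv.isProj {P Q : H →L[ℂ] H} (h : MvNEquiv A P Q) (hP : IsProj A P) :
    IsProj A Q := by
  obtain ⟨V, hV, rfl, rfl⟩ := h
  exact ⟨mul_mem hV (star_mem hV), isStarProjection_final hP.isStarProjection⟩

theorem MvNEquiv.trans {P Q R : H →L[ℂ] H} (h : MvNEquiv A P Q) (h' : MvNEquiv A Q R)
    (hP : IsProj A P) : MvNEquiv A P R := by
  have hQ := h.isProj hP
  obtain ⟨V, hV, rfl, rfl⟩ := h
  obtain ⟨W, hW, h1, rfl⟩ := h'
  refine ⟨W * V, mul_mem hW hV, ?_, ?_⟩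
  · calc star (W * V) * (W * V) = star V * (star W * W) * V := by
          rw [star_mul]; noncomm_ring
      _ = star V * (V * star V * V) := by rw [h1]; noncomm_ring
      _ = star V * V := by rw [final_mul hQ.isStarProjection]
  · calc W * V * star (W * V) = W * (V * star V) * star W := by
          rw [star_mul]; noncomm_ring
      _ = W * (star W * W) * star W := by rw [h1]
      _ = W * star W := by rw [mul_initial (h1 ▸ hQ.isStarProjection)]

theorem MvNEquiv.eq_zero {P : H →L[ℂ] H} (h : MvNEquiv A P 0) : P = 0 := by
  obtain ⟨V, -, rfl, h2⟩ := h
  rw [CStarRing.mul_star_self_eq_zero_iff] at h2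
  rw [h2, mul_zero]

theorem star_mul_eq_zero_of_final {V W : H →L[ℂ] H} (hV : IsStarProjection (star V * V))
    (hW : IsStarProjection (star W * W)) (h : V * star V * (W * star W) = 0) : star V * W = 0 := by
  calc star V * W = star (V * (star V * V)) * (W * (star W * W)) := by
        rw [mul_initial hV, mul_initial hW]
    _ = star V * (V * star V * (W * star W)) * W := by
        simp only [star_mul, star_star]; noncomm_ring
    _ = 0 := by rw [h, mul_zero, zero_mul]

theorem mul_star_eq_zero_of_initial {V W : H →L[ℂ] H} (hV : IsStarProjection (star V * V))
    (hW : IsStarProjection (star W * W)) (h : star V * V * (star W * W) = 0) : V * star W = 0 := by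
  calc V * star W = V * (star V * V) * star (W * (star W * W)) := by
        rw [mul_initial hV, mul_initial hW]
    _ = V * (star V * V * (star W * W)) * star W := by
        simp only [star_mul, star_star]; noncomm_ring
    _ = 0 := by rw [h, mul_zero, zero_mul]

theorem MvNEquiv.add {P Q P' Q' : H →L[ℂ] H} (h : MvNEquiv A P Q) (h' : MvNEquiv A P' Q')
    (hP : IsProj A P) (hP' : IsProj A P') (h0 : P * P' = 0) (h1 : Q * Q' = 0) :
    MvNEquiv A (P + P') (Q + Q') := by
  obtain ⟨V, hV, rfl, rfl⟩ := h
  obtain ⟨W, hW, rfl, rfl⟩ := h'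
  have a := star_mul_eq_zero_of_final hP.isStarProjection hP'.isStarProjection h1
  have b := mul_star_eq_zero_of_initial hP.isStarProjection hP'.isStarProjection h0
  have a' : star W * V = 0 := by simpa using congr(star $a)
  have b' : W * star V = 0 := by simpa using congr(star $b)
  exact ⟨V + W, add_mem hV hW, by simp [add_mul, mul_add, a, a'], by simp [add_mul, mul_add, b, b']⟩

/-- An equivalence `P ∼ Q` carries a subprojection of `P` to an equivalent subprojection of `Q`,
and the complement to the complement. -/
theorem MvNEquiv.exists_subproj {P Q R : H →L[ℂ] H} (h : MvNEquiv A P Q) (hP : IsProj A P)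
    (hR : IsSubproj A R P) :
    ∃ S, IsSubproj A S Q ∧ MvNEquiv A R S ∧ MvNEquiv A (P - R) (Q - S) ∧ (S = Q → R = P) := by
  have hQ := h.isProj hP
  obtain ⟨V, hV, rfl, rfl⟩ := h
  have e : ∀ T, IsSubproj A T (star V * V) → MvNEquiv A T (V * T * star V) := by
    intro T hT
    refine ⟨V * T, mul_mem hV hT.isProj.mem, ?_, ?_⟩
    · calc star (V * T) * (V * T) = T * (star V * V * T) := by
            rw [star_mul, hT.isProj.star_eq]; noncomm_ring
        _ = T := by rw [hT.mul_eq, hT.isProj.mul_self]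
    · calc V * T * star (V * T) = V * (T * T) * star V := by
            rw [star_mul, hT.isProj.star_eq]; noncomm_ring
        _ = _ := by rw [hT.isProj.mul_self]
  have hPR := hR.sub_subproj hP
  refine ⟨V * R * star V, ⟨(e R hR).isProj hR.isProj, ?_⟩, e R hR, ?_, ?_⟩
  · calc V * star V * (V * R * star V) = V * star V * V * R * star V := by noncomm_ring
      _ = _ := by rw [final_mul hQ.isStarProjection]
  · have := e _ hPR
    have h3 : V * (star V * V - R) * star V = V * star V - V * R * star V := by
      calc V * (star V * V - R) * star V = V * (star V * V) * star V - V * R * star V := by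
            noncomm_ring
        _ = _ := by rw [mul_initial hP.isStarProjection]
    rwa [h3] at this
  · intro h4
    calc R = star V * V * (R * (star V * V)) := by rw [hR.mul_eq' hP, hR.mul_eq]
      _ = star V * (V * R * star V) * V := by noncomm_ring
      _ = star V * V * (star V * V) := by rw [h4]; noncomm_ring
      _ = _ := hP.mul_self

/-- A subprojection of Q equivalent to Q is transported to one of P equivalent to P; the latter is
all of P, and properness is preserved by the transport. -/
theorem IsFiniteProj.of_equiv {P Q : H →L[ℂ] H} (hP : IsFiniteProj A P) (h : MvNEquiv A P Q) :
    IsFiniteProj A Q := by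
  have hQ := h.isProj hP.isProj
  refine ⟨hQ, fun Q₁ h1 h2 => ?_⟩
  obtain ⟨S, hS, h3, -, h5⟩ := h.symm.exists_subproj hQ h1
  exact h5 (hP.eq_of_equiv S hS
    ((h3.symm.trans h2 hS.isProj).trans h.symm hS.isProj))

/-- If Q₁ ≤ Q and Q₁ ∼ Q, adding P - Q to both sides gives a subprojection of P equivalent to P. -/
theorem IsFiniteProj.of_subproj {P Q : H →L[ℂ] H} (hP : IsFiniteProj A P) (h : IsSubproj A Q P) :
    IsFiniteProj A Q := by
  refine ⟨h.isProj, fun Q₁ h1 h2 => ?_⟩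
  have hs := h.sub hP.isProj
  have hz := h.mul_sub_eq_zero hP.isProj
  have hz1 : Q₁ * (P - Q) = 0 := by
    rw [← h1.mul_eq' h.isProj, mul_assoc, hz, mul_zero]
  have h3 := h2.add (MvNEquiv.refl hs) h1.isProj hs hz1 hz
  rw [add_sub_cancel] at h3
  have h4 := hP.eq_of_equiv _ ⟨h1.isProj.add hs hz1, by
    rw [mul_add, mul_sub, hP.isProj.mul_self, h.mul_eq, (h1.trans h).mul_eq]⟩ h3
  have : Q₁ + (P - Q) = Q + (P - Q) := by rw [h4, add_sub_cancel]
  exact add_right_cancel this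

end PartialIsometry

/-! ### Strong sums of orthogonal families. -/

section StrongSum

theorem mul_eq_zero_of_hasSum {H : Type u} [NormedAddCommGroup H] [InnerProductSpace ℂ H]
    {I : Type*} {P : I → H →L[ℂ] H} {S T : H →L[ℂ] H}
    (hS : ∀ x, HasSum (fun i => P i x) (S x)) (h : ∀ i, T * P i = 0) : T * S = 0 := by
  ext x
  refine ((hS x).mapL T).unique ?_
  have : ∀ i, T (P i x) = 0 := fun i => congr($(h i) x)
  simp only [this]
  exact hasSum_zero

variable {H : Type u} [NormedAddCommGroup H] [InnerProductSpace ℂ H] [CompleteSpace H]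
  {A : VonNeumannAlgebra H} {I : Type*}

/-- The bicommutant property in pointwise form, used to put limits and polar parts into A. -/
theorem mem_iff_forall_commutant {T : H →L[ℂ] H} :
    T ∈ A ↔ ∀ y ∈ A.commutant, ∀ x, y (T x) = T (y x) := by
  constructor
  · intro hT y hy x
    exact (congr($(VonNeumannAlgebra.mem_commutant_iff.1 hy T hT) x)).symm
  · intro h
    rw [← A.commutant_commutant, VonNeumannAlgebra.mem_commutant_iff]
    exact fun y hy => ContinuousLinearMap.ext (h y hy)

/-- A pointwise sum of operators of `A` belongs to `A`. -/
theorem mem_of_hasSum {V : I → H →L[ℂ] H} {W : H →L[ℂ] H} (hV : ∀ i, V i ∈ A)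
    (h : ∀ x, HasSum (fun i => V i x) (W x)) : W ∈ A := by
  rw [mem_iff_forall_commutant]
  intro y hy x
  refine HasSum.unique ((h x).mapL y) ?_
  have : ∀ i, y (V i x) = V i (y x) := fun i => mem_iff_forall_commutant.1 (hV i) y hy x
  simpa only [this] using h (y x)

theorem inner_projSpace_eq_zero {P Q : H →L[ℂ] H} (hP : IsStarProjection P) (h : P * Q = 0)
    {x y : H} (hx : x ∈ projSpace P) (hy : y ∈ projSpace Q) : inner ℂ x y = 0 := by
  rw [mem_projSpace] at hx hy
  have hs : P.adjoint = P := hP.isSelfAdjoint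
  rw [← hx, ← hy, ← hs, ContinuousLinearMap.adjoint_inner_left]
  have : P (Q y) = 0 := congr($h y)
  rw [this, inner_zero_right]

theorem orthogonalFamily_projSpace {P : I → H →L[ℂ] H} (hP : ∀ i, IsStarProjection (P i))
    (h : ∀ i j, i ≠ j → P i * P j = 0) :
    OrthogonalFamily ℂ (fun i => projSpace (P i)) fun i => (projSpace (P i)).subtypeₗᵢ :=
  fun i j hij v w => inner_projSpace_eq_zero (hP i) (h i j hij) v.2 w.2

theorem isStarProjection_sum {P : I → H →L[ℂ] H} (hP : ∀ i, IsStarProjection (P i))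
    (h : ∀ i j, i ≠ j → P i * P j = 0) (s : Finset I) : IsStarProjection (∑ i ∈ s, P i) := by
  classical
  constructor
  · rw [IsIdempotentElem, Finset.sum_mul_sum]
    refine Finset.sum_congr rfl fun i hi => ?_
    rw [Finset.sum_eq_single_of_mem i hi fun j _ hj => h i j hj.symm]
    exact (hP i).isIdempotentElem.eq
  · rw [isSelfAdjoint_iff, star_sum]
    exact Finset.sum_congr rfl fun i _ => (hP i).isSelfAdjoint

theorem norm_apply_le_of_isStarProjection {P : H →L[ℂ] H} (hP : IsStarProjection P) (x : H) :
    ‖P x‖ ≤ ‖x‖ :=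
  (P.le_of_opNorm_le (hP.norm_le) x).trans (one_mul ‖x‖).le

theorem norm_apply_eq_initial (V : H →L[ℂ] H) (hV : IsStarProjection (star V * V)) (x : H) :
    ‖V x‖ = ‖(star V * V) x‖ := by
  have h1 : ‖V x‖ ^ 2 = RCLike.re (inner ℂ (V.adjoint (V x)) x) := by
    rw [ContinuousLinearMap.adjoint_inner_left, inner_self_eq_norm_sq]
  have h2 : ‖(star V * V) x‖ ^ 2 = RCLike.re (inner ℂ (V.adjoint (V x)) x) := by
    rw [← inner_self_eq_norm_sq (𝕜 := ℂ)]
    have hs : (star V * V).adjoint = star V * V := hV.isSelfAdjoint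
    have hi : (star V * V) ((star V * V) x) = (star V * V) x := congr($(hV.isIdempotentElem.eq) x)
    conv_lhs => enter [2, 3]; rw [← hs]
    rw [ContinuousLinearMap.adjoint_inner_right, hi]
    rfl
  exact (sq_eq_sq₀ (norm_nonneg _) (norm_nonneg _)).1 (h1.trans h2.symm)

/-- The vectors V_i x are orthogonal, and their norms are those of the orthogonal components V_i*
V_i x of x. Bessel's inequality gives both the convergence and the bound 1 on the norm of the sum.
-/
theorem exists_strong_sum_aux {V : I → H →L[ℂ] H}
    (hV : ∀ i, IsStarProjection (star (V i) * V i))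
    (hl : ∀ i j, i ≠ j → star (V i) * V j = 0) (hr : ∀ i j, i ≠ j → V i * star (V j) = 0) :
    ∃ W : H →L[ℂ] H, ∀ x, HasSum (fun i => V i x) (W x) := by
  have hP : ∀ i j, i ≠ j → (star (V i) * V i) * (star (V j) * V j) = 0 := fun i j hij => by
    calc _ = star (V i) * (V i * star (V j)) * V j := by noncomm_ring
      _ = 0 := by rw [hr i j hij, mul_zero, zero_mul]
  have hQ : ∀ i j, i ≠ j → (V i * star (V i)) * (V j * star (V j)) = 0 := fun i j hij => by
    calc _ = V i * (star (V i) * V j) * star (V j) := by noncomm_ring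
      _ = 0 := by rw [hl i j hij, mul_zero, zero_mul]
  have hQs := fun i => isStarProjection_final (hV i)
  have hoP := orthogonalFamily_projSpace hV hP
  have hoQ := orthogonalFamily_projSpace hQs hQ
  have memP : ∀ i x, (star (V i) * V i) x ∈ projSpace (star (V i) * V i) := fun i x =>
    mem_projSpace.2 congr($((hV i).isIdempotentElem.eq) x)
  have memQ : ∀ i x, V i x ∈ projSpace (V i * star (V i)) := fun i x =>
    mem_projSpace.2 congr($(final_mul (hQs i)) x)
  have bound : ∀ x (s : Finset I), ∑ i ∈ s, ‖V i x‖ ^ 2 ≤ ‖x‖ ^ 2 := by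
    intro x s
    have h1 := hoP.norm_sum (fun i => ⟨_, memP i x⟩) s
    have h2 := norm_apply_le_of_isStarProjection (isStarProjection_sum hV hP s) x
    calc ∑ i ∈ s, ‖V i x‖ ^ 2 = ‖(∑ i ∈ s, (star (V i) * V i)) x‖ ^ 2 := by
          rw [sum_apply]
          refine Eq.trans ?_ h1.symm
          exact Finset.sum_congr rfl fun i _ => by rw [norm_apply_eq_initial _ (hV i)]; rfl
      _ ≤ _ := by gcongr
  have hsum : ∀ x, Summable fun i => V i x := by
    intro x
    have := (hoQ.summable_iff_norm_sq_summable fun i => ⟨V i x, memQ i x⟩).2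
      (summable_of_sum_le (fun i => by positivity) (bound x))
    exact this
  have hnorm : ∀ x, ‖∑' i, V i x‖ ≤ 1 * ‖x‖ := by
    intro x
    rw [one_mul]
    refine le_of_tendsto (hsum x).hasSum.norm (Filter.Eventually.of_forall fun s => ?_)
    have h1 := hoQ.norm_sum (fun i => ⟨_, memQ i x⟩) s
    refine (sq_le_sq₀ (norm_nonneg _) (norm_nonneg _)).1 ?_
    exact h1.trans_le (bound x s)
  refine ⟨LinearMap.mkContinuous
    { toFun := fun x => ∑' i, V i x
      map_add' := fun x y => by simp only [map_add]; exact (hsum x).tsum_add (hsum y)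
      map_smul' := fun c x => by
        simp only [map_smul, RingHom.id_apply]; exact (hsum x).tsum_const_smul c } 1 hnorm,
    fun x => (hsum x).hasSum⟩

/-- A family of partial isometries of `A` with mutually orthogonal initial and mutually orthogonal
final projections has a strong sum in `A`. -/
theorem exists_strong_sum {V : I → H →L[ℂ] H} (hmem : ∀ i, V i ∈ A)
    (hV : ∀ i, IsStarProjection (star (V i) * V i))
    (hl : ∀ i j, i ≠ j → star (V i) * V j = 0) (hr : ∀ i j, i ≠ j → V i * star (V j) = 0) :
    ∃ W ∈ A, (∀ x, HasSum (fun i => V i x) (W x)) ∧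
      (∀ x, HasSum (fun i => (star (V i) * V i) x) ((star W * W) x)) ∧
      (∀ x, HasSum (fun i => (V i * star (V i)) x) ((W * star W) x)) := by
  obtain ⟨W, hW⟩ := exists_strong_sum_aux hV hl hr
  obtain ⟨W', hW'⟩ := exists_strong_sum_aux (V := fun i => star (V i))
    (fun i => by simpa using isStarProjection_final (hV i))
    (fun i j hij => by simpa using hr i j hij) (fun i j hij => by simpa using hl i j hij)
  -- Taking adjoints is not strongly continuous, so the adjoints are summed separately and
  -- identified through weak sums.
  have hs : star W = W' := by
    rw [ContinuousLinearMap.star_eq_adjoint, eq_comm, ContinuousLinearMap.eq_adjoint_iff]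
    intro x y
    have h1 : HasSum (fun i => inner ℂ (star (V i) x) y) (inner ℂ (W' x) y) :=
      ((innerSL ℂ).flip y).hasSum (hW' x)
    have h2 : HasSum (fun i => inner ℂ x (V i y)) (inner ℂ x (W y)) := (hW y).mapL (innerSL ℂ x)
    refine h1.unique ?_
    simpa only [ContinuousLinearMap.star_eq_adjoint,
      ContinuousLinearMap.adjoint_inner_left] using h2
  -- Orthogonality of the final projections kills every other term, so W* applied to W x is the sum
  -- of V_i* V_i x.
  have e1 : ∀ i, star (V i) * W = star (V i) * V i := by
    intro i
    ext x
    refine ((hW x).mapL (star (V i))).unique ?_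
    have := hasSum_single (f := fun j => star (V i) (V j x)) i
      (fun j hj => congr($(hl i j hj.symm) x))
    exact this
  have e2 : ∀ i, V i * W' = V i * star (V i) := by
    intro i
    ext x
    refine ((hW' x).mapL (V i)).unique ?_
    have := hasSum_single (f := fun j => V i (star (V j) x)) i
      (fun j hj => congr($(hr i j hj.symm) x))
    exact this
  refine ⟨W, mem_of_hasSum hmem hW, hW, fun x => ?_, fun x => ?_⟩
  · simp only [← e1, hs]
    exact hW' (W x)
  · simp only [← e2, hs]
    exact hW (W' x)

/-- A family of mutually orthogonal projections of `A` has a strong sum in `A`, a projection. -/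
theorem exists_strong_sum_proj {P : I → H →L[ℂ] H} (hP : ∀ i, IsProj A (P i))
    (h : ∀ i j, i ≠ j → P i * P j = 0) :
    ∃ S, IsProj A S ∧ ∀ x, HasSum (fun i => P i x) (S x) := by
  have hs : ∀ i, star (P i) * P i = P i := fun i => by rw [(hP i).star_eq, (hP i).mul_self]
  obtain ⟨W, hW, h1, h2, -⟩ := exists_strong_sum (A := A) (V := P) (fun i => (hP i).mem)
    (fun i => by rw [hs]; exact (hP i).isStarProjection)
    (fun i j hij => by rw [(hP i).star_eq, h i j hij])
    (fun i j hij => by rw [(hP j).star_eq, h i j hij])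
  -- This single identity yields both self-adjointness and idempotence.
  have e : star W * W = W := by
    ext x
    exact (h2 x).unique (by simpa only [hs] using h1 x)
  have hsa : star W = W := by
    conv_lhs => rw [← e]
    rw [star_mul, star_star, e]
  exact ⟨W, ⟨hW, ⟨by rwa [hsa] at e, hsa⟩⟩, h1⟩

/-- Strong sums of equivalent orthogonal families are equivalent. -/
theorem MvNEquiv.of_hasSum {P Q : I → H →L[ℂ] H} {S T : H →L[ℂ] H} (hP : ∀ i, IsProj A (P i))
    (hPQ : ∀ i, MvNEquiv A (P i) (Q i)) (hPo : ∀ i j, i ≠ j → P i * P j = 0)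
    (hQo : ∀ i j, i ≠ j → Q i * Q j = 0) (hS : ∀ x, HasSum (fun i => P i x) (S x))
    (hT : ∀ x, HasSum (fun i => Q i x) (T x)) : MvNEquiv A S T := by
  choose V hV h1 h2 using hPQ
  have hp : ∀ i, IsStarProjection (star (V i) * V i) := fun i => h1 i ▸ (hP i).isStarProjection
  obtain ⟨W, hW, -, h3, h4⟩ := exists_strong_sum hV hp
    (fun i j hij => star_mul_eq_zero_of_final (hp i) (hp j) (by rw [h2, h2, hQo i j hij]))
    (fun i j hij => mul_star_eq_zero_of_initial (hp i) (hp j) (by rw [h1, h1, hPo i j hij]))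
  refine ⟨W, hW, ?_, ?_⟩ <;> ext x
  · exact (h3 x).unique (by simpa only [h1] using hS x)
  · exact (h4 x).unique (by simpa only [h2] using hT x)

theorem mul_of_hasSum {P : I → H →L[ℂ] H} {S : H →L[ℂ] H} (hP : ∀ i, IsProj A (P i))
    (h : ∀ i j, i ≠ j → P i * P j = 0) (hS : ∀ x, HasSum (fun i => P i x) (S x)) (i : I) :
    S * P i = P i := by
  ext x
  refine (hS (P i x)).unique ?_
  have := hasSum_single (f := fun j => P j (P i x)) i (fun j hj => congr($(h j i hj) x))
  rwa [(hP i).apply_apply] at this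

theorem isSubproj_of_hasSum {P : I → H →L[ℂ] H} {S Q : H →L[ℂ] H} (hS : IsProj A S)
    (hs : ∀ x, HasSum (fun i => P i x) (S x)) (h : ∀ i, Q * P i = P i) : IsSubproj A S Q := by
  refine ⟨hS, ?_⟩
  ext x
  refine ((hs x).mapL Q).unique ?_
  have : ∀ i, Q (P i x) = P i x := fun i => congr($(h i) x)
  simpa only [this] using hs x

end StrongSum

/-! ### Polar decomposition and comparison of projections in a factor. -/

section Comparison

variable {H : Type u} [NormedAddCommGroup H] [InnerProductSpace ℂ H] [CompleteSpace H]
  {A : VonNeumannAlgebra H}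

theorem inner_apply_of_star_eq {S : H →L[ℂ] H} (hS : star S = S) (x y : H) :
    inner ℂ (S x) y = inner ℂ x (S y) := by
  conv_lhs => rw [← hS]
  exact ContinuousLinearMap.adjoint_inner_left _ _ _

/-- Operators that agree on the range and on the kernel of a self-adjoint operator are equal. -/
theorem ext_range_ker {S : H →L[ℂ] H} (hS : star S = S) {X Y : H →L[ℂ] H}
    (h1 : X * S = Y * S) (h2 : ∀ z, S z = 0 → X z = Y z) : X = Y := by
  -- The range of (X - Y)* lies in the kernel of S, where X - Y vanishes; hence (X - Y)(X - Y)* = 0.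
  have h3 : S * star (X - Y) = 0 := by
    have : (X - Y) * S = 0 := by rw [sub_mul, h1, sub_self]
    simpa [hS] using congr(star $this)
  rw [← sub_eq_zero, ← CStarRing.mul_star_self_eq_zero_iff]
  ext z
  have h4 : S (star (X - Y) z) = 0 := congr($h3 z)
  have h5 := h2 _ h4
  change (X - Y) (star (X - Y) z) = 0
  rw [sub_apply, h5, sub_self]

/-- Polar decomposition in `A`: every `T ∈ A` has a partial isometry `V ∈ A` with the same
kernel, and whose adjoint has the same kernel as the adjoint of `T`. -/
theorem exists_polar {T : H →L[ℂ] H} (hT : T ∈ A) :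
    ∃ V ∈ A, IsStarProjection (star V * V) ∧ (∀ x, V x = 0 ↔ T x = 0) ∧
      ∀ x, star V x = 0 ↔ star T x = 0 := by
  set S : H →L[ℂ] H := CFC.abs T with hSdef
  have hSs : star S = S := (CFC.abs_nonneg T).isSelfAdjoint
  have hSS : S * S = star T * T := CFC.abs_mul_abs T
  have hSA : S ∈ A := by
    rw [← A.commutant_commutant, VonNeumannAlgebra.mem_commutant_iff]
    intro y hy
    have h1 : Commute T y := VonNeumannAlgebra.mem_commutant_iff.1 hy T hT
    have h2 : Commute T (star y) := VonNeumannAlgebra.mem_commutant_iff.1 (star_mem hy) T hT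
    exact (h1.cfcAbs_left h2).symm.eq
  have hin : ∀ x y, inner ℂ (T x) (T y) = inner ℂ (S x) (S y) := by
    intro x y
    rw [← ContinuousLinearMap.adjoint_inner_right, ← ContinuousLinearMap.star_eq_adjoint,
      inner_apply_of_star_eq hSs]
    exact congr(inner ℂ x ($hSS.symm y))
  have hnorm : ∀ x, ‖T x‖ = ‖S x‖ := fun x => by
    rw [norm_eq_sqrt_re_inner (𝕜 := ℂ), norm_eq_sqrt_re_inner (𝕜 := ℂ), hin]
  have hker : ∀ x, S x = 0 ↔ T x = 0 := fun x => by
    rw [← norm_eq_zero, ← hnorm, norm_eq_zero]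
  let M : Submodule ℂ H := S.range.topologicalClosure
  have : CompleteSpace M := (Submodule.isClosed_topologicalClosure _).completeSpace_coe
  let e : H →ₗ[ℂ] M := S.toLinearMap.codRestrict M fun x =>
    Submodule.le_topologicalClosure _ ⟨x, rfl⟩
  have he : DenseRange e := by
    intro m
    rw [Metric.mem_closure_iff]
    intro ε hε
    obtain ⟨_, ⟨x, rfl⟩, hx⟩ := Metric.mem_closure_iff.1 m.2 ε hε
    exact ⟨e x, ⟨x, rfl⟩, hx⟩
  -- Since ‖T x‖ = ‖S x‖, the map S x ↦ T x extends isometrically to the closure of the range of S.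
  let V₀ : M →L[ℂ] H := T.toLinearMap.extendOfNorm e
  have hV₀ : ∀ x, V₀ (e x) = T x :=
    LinearMap.extendOfNorm_eq he ⟨1, fun x => by rw [one_mul]; exact (hnorm x).le⟩
  have hV₀n : ∀ m, ‖V₀ m‖ = ‖m‖ := by
    intro m
    refine he.induction_on m (isClosed_eq (by fun_prop) (by fun_prop)) fun x => ?_
    rw [hV₀]
    exact hnorm x
  let p : H →L[ℂ] M := M.orthogonalProjectionOnto
  let V : H →L[ℂ] H := V₀ ∘L p
  have hp : ∀ x, S x = 0 → p x = 0 := by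
    intro x hx
    rw [Submodule.orthogonalProjectionOnto_eq_zero_iff, Submodule.orthogonal_closure,
      Submodule.mem_orthogonal]
    rintro _ ⟨y, rfl⟩
    change inner ℂ (S y) x = 0
    rw [inner_apply_of_star_eq hSs, hx, inner_zero_right]
  have hp' : ∀ x, p x = 0 → S x = 0 := by
    intro x hx
    rw [Submodule.orthogonalProjectionOnto_eq_zero_iff, Submodule.orthogonal_closure,
      Submodule.mem_orthogonal] at hx
    rw [← inner_self_eq_zero (𝕜 := ℂ), ← inner_apply_of_star_eq hSs]
    exact hx _ ⟨S x, rfl⟩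
  have hpS : ∀ x, p (S x) = e x := fun x =>
    Submodule.orthogonalProjectionOnto_mem_subspace_eq_self (e x)
  have hVS : V * S = T := by
    ext x
    change V₀ (p (S x)) = T x
    rw [hpS, hV₀]
  have hVk : ∀ x, V x = 0 ↔ S x = 0 := by
    intro x
    constructor
    · intro h
      refine hp' x ?_
      rw [← norm_eq_zero, ← hV₀n, norm_eq_zero]
      exact h
    · intro h
      change V₀ (p x) = 0
      rw [hp x h, map_zero]
  have hVA : V ∈ A := by
    rw [mem_iff_forall_commutant]
    intro y hy x
    have hyS := mem_iff_forall_commutant.1 hSA y hy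
    have hyT := mem_iff_forall_commutant.1 hT y hy
    -- On the range of S this follows from VS = T and from y commuting with S and T; on the kernel
    -- of S both sides vanish.
    have : y * V = V * y := by
      refine ext_range_ker hSs ?_ ?_
      · ext z
        have h1 : ∀ z, V (S z) = T z := fun z => congr($hVS z)
        change y (V (S z)) = V (y (S z))
        rw [h1, hyS, h1, hyT]
      · intro z hz
        change y (V z) = V (y z)
        rw [(hVk z).2 hz, map_zero, eq_comm, hVk, ← hyS, hz, map_zero]
    exact congr($this x)
  have hVV : star V * V = M.starProjection := by
    let L : M →ₗᵢ[ℂ] H := ⟨V₀.toLinearMap, hV₀n⟩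
    ext x
    refine ext_inner_left ℂ fun y => ?_
    change inner ℂ y (V.adjoint (V x)) = inner ℂ y (p x : H)
    rw [ContinuousLinearMap.adjoint_inner_right]
    change inner ℂ (L (p y)) (L (p x)) = _
    rw [L.inner_map_map]
    exact Submodule.inner_orthogonalProjectionOnto_eq_of_mem_right (p x) y
  refine ⟨V, hVA, hVV ▸ isStarProjection_starProjection, fun x => (hVk x).trans (hker x),
    fun x => ?_⟩
  have hT' : star T = S * star V := by rw [← hVS, star_mul, hSs]
  rw [hT']
  change _ ↔ S (star V x) = 0
  constructor
  · intro h
    rw [h, map_zero]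
  · intro h
    rw [← hVk] at h
    have h1 : star V (V (star V x)) = star V x := by
      have := mul_initial (hVV ▸ isStarProjection_starProjection : IsStarProjection (star V * V))
      have h2 : star V * V * star V = star V := by simpa [mul_assoc] using congr(star $this)
      exact congr($h2 x)
    rw [← h1, h, map_zero]

/-- In a factor, nonzero projections `P`, `Q` of `A` satisfy `Q A P ≠ 0`. -/
theorem IsFactor.exists_mul_mul_ne_zero (hA : IsFactor A) {P Q : H →L[ℂ] H} (hQ : IsProj A Q)
    (hP0 : P ≠ 0) (hQ0 : Q ≠ 0) : ∃ T ∈ A, Q * T * P ≠ 0 := by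
  by_contra! h
  -- K is the annihilated subspace {x | QAx = 0}; invariance under A and A' puts its projection into
  -- the centre.
  let K : Submodule ℂ H := ⨅ T ∈ A, (Q * T).ker
  have memK : ∀ x, x ∈ K ↔ ∀ T ∈ A, Q (T x) = 0 := by
    intro x
    simp only [K, Submodule.mem_iInf]
    rfl
  have hKc : IsClosed (K : Set H) := by
    have : (K : Set H) = ⋂ T ∈ A, ((Q * T).ker : Set H) := by simp [K]
    rw [this]
    exact isClosed_biInter fun T _ => (Q * T).isClosed_ker
  have : CompleteSpace K := hKc.completeSpace_coe
  have hs : IsStarProjection K.starProjection := isStarProjection_starProjection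
  have h1 : K.starProjection ∈ A := by
    rw [VonNeumannAlgebra.IsStarProjection.mem_iff hs]
    intro y hy x hx
    rw [Submodule.range_starProjection, memK] at hx
    rw [Submodule.mem_comap, Submodule.range_starProjection, memK]
    intro T hT
    change Q (T (y x)) = 0
    rw [← mem_iff_forall_commutant.1 hT y hy, ← mem_iff_forall_commutant.1 hQ.mem y hy, hx T hT,
      map_zero]
  have h2 : K.starProjection ∈ A.commutant := by
    rw [VonNeumannAlgebra.IsStarProjection.mem_iff hs, A.commutant_commutant]
    intro y hy x hx
    rw [Submodule.range_starProjection, memK] at hx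
    rw [Submodule.mem_comap, Submodule.range_starProjection, memK]
    intro T hT
    exact hx (T * y) (mul_mem hT hy)
  obtain ⟨c, hc⟩ := hA _ h1 h2
  obtain ⟨x, hx⟩ : ∃ x, P x ≠ 0 := by
    by_contra! h0
    exact hP0 (ContinuousLinearMap.ext h0)
  have hPK : P x ∈ K := (memK _).2 fun T hT => congr($(h T hT) x)
  have h3 : K.starProjection (P x) = P x := Submodule.starProjection_eq_self_iff.2 hPK
  have h4 : c = 1 := by
    rw [hc] at h3
    have h5 : (c - 1) • P x = 0 := by
      rw [sub_smul, one_smul, sub_eq_zero]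
      exact h3
    exact sub_eq_zero.1 ((smul_eq_zero.1 h5).resolve_right hx)
  refine hQ0 (ContinuousLinearMap.ext fun z => ?_)
  have h6 : z ∈ K := by
    rw [← Submodule.starProjection_eq_self_iff, hc, h4, one_smul]
    rfl
  exact (memK z).1 h6 1 (one_mem A)

/-- Comparison in a factor: of two projections one is equivalent to a subprojection of the
other. -/
theorem IsFactor.comparison (hA : IsFactor A) {P Q : H →L[ℂ] H} (hP : IsProj A P)
    (hQ : IsProj A Q) :
    (∃ Q', IsSubproj A Q' Q ∧ MvNEquiv A P Q') ∨ ∃ P', IsSubproj A P' P ∧ MvNEquiv A P' Q := by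
  -- Families of partial isometries from parts of P to parts of Q, with orthogonal initial and final
  -- projections.
  let F : Set (Set (H →L[ℂ] H)) := {s | (∀ V ∈ s, V ∈ A ∧ IsStarProjection (star V * V) ∧
    V * P = V ∧ Q * V = V) ∧ ∀ V ∈ s, ∀ W ∈ s, V ≠ W → star V * W = 0 ∧ V * star W = 0}
  obtain ⟨s, hs⟩ : ∃ s, Maximal (· ∈ F) s := by
    refine zorn_subset F fun c hcF hc => ⟨⋃₀ c, ⟨?_, ?_⟩, fun s hs => Set.subset_sUnion_of_mem hs⟩
    · rintro V ⟨t, ht, hV⟩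
      exact (hcF ht).1 V hV
    · rintro V ⟨t, ht, hV⟩ W ⟨t', ht', hW⟩ hne
      rcases hc.total ht ht' with h | h
      · exact (hcF ht').2 V (h hV) W hW hne
      · exact (hcF ht).2 V hV W (h hW) hne
  have hsF : s ∈ F := hs.prop
  obtain ⟨W, hW, -, h2, h3⟩ := exists_strong_sum (A := A) (V := fun V : s => (V : H →L[ℂ] H))
    (fun V => (hsF.1 V V.2).1) (fun V => (hsF.1 V V.2).2.1)
    (fun V V' h => (hsF.2 V V.2 V' V'.2 (Subtype.coe_ne_coe.2 h)).1)
    (fun V V' h => (hsF.2 V V.2 V' V'.2 (Subtype.coe_ne_coe.2 h)).2)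
  have hi : ∀ V : s, IsProj A (star (V : H →L[ℂ] H) * V) := fun V =>
    ⟨mul_mem (star_mem (hsF.1 V V.2).1) (hsF.1 V V.2).1, (hsF.1 V V.2).2.1⟩
  have hf : ∀ V : s, IsProj A ((V : H →L[ℂ] H) * star (V : H →L[ℂ] H)) := fun V =>
    ⟨mul_mem (hsF.1 V V.2).1 (star_mem (hsF.1 V V.2).1), isStarProjection_final (hi V).2⟩
  have hio : ∀ V V' : s, V ≠ V' →
      star (V : H →L[ℂ] H) * V * (star (V' : H →L[ℂ] H) * V') = 0 := fun V V' h => by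
    calc _ = star (V : H →L[ℂ] H) * (V * star (V' : H →L[ℂ] H)) * V' := by noncomm_ring
      _ = 0 := by rw [(hsF.2 V V.2 V' V'.2 (Subtype.coe_ne_coe.2 h)).2, mul_zero, zero_mul]
  have hfo : ∀ V V' : s, V ≠ V' →
      (V : H →L[ℂ] H) * star (V : H →L[ℂ] H) * (V' * star (V' : H →L[ℂ] H)) = 0 := fun V V' h => by
    calc _ = (V : H →L[ℂ] H) * (star (V : H →L[ℂ] H) * V') * star (V' : H →L[ℂ] H) := by
            noncomm_ring
      _ = 0 := by rw [(hsF.2 V V.2 V' V'.2 (Subtype.coe_ne_coe.2 h)).1, mul_zero, zero_mul]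
  have hP' : IsProj A (star W * W) := by
    obtain ⟨S, hS, hS'⟩ := exists_strong_sum_proj hi hio
    have : star W * W = S := by
      ext x
      exact (h2 x).unique (hS' x)
    rwa [this]
  have hsubP : IsSubproj A (star W * W) P := isSubproj_of_hasSum hP' h2 fun V => by
    have : P * star (V : H →L[ℂ] H) = star (V : H →L[ℂ] H) := by
      simpa [hP.star_eq] using congr(star $((hsF.1 V V.2).2.2.1))
    rw [← mul_assoc, this]
  have hQ' : IsProj A (W * star W) :=
    ⟨mul_mem hW (star_mem hW), isStarProjection_final hP'.isStarProjection⟩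
  have hsubQ : IsSubproj A (W * star W) Q := isSubproj_of_hasSum hQ' h3 fun V => by
    rw [← mul_assoc, (hsF.1 V V.2).2.2.2]
  have hPQ : MvNEquiv A (star W * W) (W * star W) := ⟨W, hW, rfl, rfl⟩
  by_cases hP0 : P - star W * W = 0
  · rw [sub_eq_zero] at hP0
    exact .inl ⟨_, hsubQ, hP0 ▸ hPQ⟩
  by_cases hQ0 : Q - W * star W = 0
  · rw [sub_eq_zero] at hQ0
    exact .inr ⟨_, hsubP, hQ0.symm ▸ hPQ⟩
  exfalso
  set P₁ := P - star W * W with hP₁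
  set Q₁ := Q - W * star W with hQ₁
  have pP₁ : IsProj A P₁ := hsubP.sub hP
  have pQ₁ : IsProj A Q₁ := hsubQ.sub hQ
  -- If both leftovers P₁ and Q₁ are nonzero, the polar part of Q₁TP₁ is orthogonal on both sides to
  -- the family.
  obtain ⟨T, hT, hne⟩ := hA.exists_mul_mul_ne_zero pQ₁ hP0 hQ0
  obtain ⟨V, hV, hVp, hk, hk'⟩ := exists_polar (mul_mem (mul_mem pQ₁.mem hT) pP₁.mem)
  have v1 : V * P₁ = V := by
    rw [← sub_eq_zero, ← neg_eq_zero, neg_sub]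
    ext x
    change V x - V (P₁ x) = 0
    rw [← map_sub, hk]
    change Q₁ (T (P₁ (x - P₁ x))) = 0
    rw [map_sub, pP₁.apply_apply, sub_self, map_zero, map_zero]
  have v2 : Q₁ * V = V := by
    have : star V * Q₁ = star V := by
      rw [← sub_eq_zero, ← neg_eq_zero, neg_sub]
      ext x
      change star V x - star V (Q₁ x) = 0
      rw [← map_sub, hk']
      simp only [star_mul, pQ₁.star_eq]
      change star P₁ (star T (Q₁ (x - Q₁ x))) = 0
      rw [map_sub, pQ₁.apply_apply, sub_self, map_zero, map_zero]
    simpa [pQ₁.star_eq] using congr(star $this)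
  have v3 : ∀ V' ∈ s, V' * star V = 0 := fun V' hV' => by
    have h5 : star W * W * (star V' * V') = star V' * V' := mul_of_hasSum hi hio h2 ⟨V', hV'⟩
    have h6 : V' * (star W * W) = V' := by
      have h7 := hP'.mul_comm_eq (hi ⟨V', hV'⟩) h5
      calc V' * (star W * W) = V' * (star V' * V') * (star W * W) := by
            rw [mul_initial (hsF.1 V' hV').2.1]
        _ = V' * (star V' * V' * (star W * W)) := by noncomm_ring
        _ = V' := by rw [h7, mul_initial (hsF.1 V' hV').2.1]
    have h8 : P₁ * star V = star V := by simpa [pP₁.star_eq] using congr(star $v1)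
    calc V' * star V = V' * (star W * W * P₁) * star V := by
          conv_lhs => rw [← h6, ← h8]
          noncomm_ring
      _ = 0 := by rw [hP₁, hsubP.mul_sub_eq_zero hP, mul_zero, zero_mul]
  have v4 : ∀ V' ∈ s, star V' * V = 0 := fun V' hV' => by
    have h5 : W * star W * (V' * star V') = V' * star V' := mul_of_hasSum hf hfo h3 ⟨V', hV'⟩
    have h6 : star V' * (W * star W) = star V' := by
      have h7 := hQ'.mul_comm_eq (hf ⟨V', hV'⟩) h5
      have h9 : star V' * (V' * star V') = star V' := by
        have := final_mul (hf ⟨V', hV'⟩).isStarProjection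
        simpa [mul_assoc] using congr(star $this)
      calc star V' * (W * star W) = star V' * (V' * star V') * (W * star W) := by rw [h9]
        _ = star V' * (V' * star V' * (W * star W)) := by noncomm_ring
        _ = star V' := by rw [h7, h9]
    calc star V' * V = star V' * (W * star W * Q₁) * V := by
          conv_lhs => rw [← h6, ← v2]
          noncomm_ring
      _ = 0 := by rw [hQ₁, hsubQ.mul_sub_eq_zero hQ, mul_zero, zero_mul]
  have hVs : V ∈ s := by
    refine hs.le_of_ge (y := insert V s) ⟨?_, ?_⟩ (Set.subset_insert V s) (Set.mem_insert V s)
    · rintro V' (rfl | hV')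
      · refine ⟨hV, hVp, ?_, ?_⟩
        · rw [← v1, mul_assoc, (hsubP.sub_subproj hP).mul_eq' hP]
        · rw [← v2, ← mul_assoc, (hsubQ.sub_subproj hQ).mul_eq]
      · exact hsF.1 V' hV'
    · rintro V' (rfl | hV') W' (rfl | hW') hne'
      · exact absurd rfl hne'
      · exact ⟨by simpa using congr(star $(v4 W' hW')), by simpa using congr(star $(v3 W' hW'))⟩
      · exact ⟨v4 V' hV', v3 V' hV'⟩
      · exact hsF.2 V' hV' W' hW' hne'
  -- By maximality V already belongs to the family, so it is orthogonal to itself.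
  have hV0 : V = 0 := by
    rw [← CStarRing.mul_star_self_eq_zero_iff]
    exact v3 V hVs
  refine hne (ContinuousLinearMap.ext fun x => (hk x).1 ?_)
  rw [hV0]
  rfl

end Comparison

/-! ### Sums of orthogonal finite projections are finite. -/

section FiniteSum

variable {H : Type u} [NormedAddCommGroup H] [InnerProductSpace ℂ H] [CompleteSpace H]
  {A : VonNeumannAlgebra H}

/-- The strong sum of a sequence of nonzero equivalent orthogonal projections is not finite. -/
theorem not_isFiniteProj_of_hasSum {E : ℕ → H →L[ℂ] H} {S : H →L[ℂ] H} (hE : ∀ n, IsProj A (E n))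
    (ho : ∀ m n, m ≠ n → E m * E n = 0) (he : ∀ n, MvNEquiv A (E n) (E (n + 1))) (h0 : E 0 ≠ 0)
    (hS : ∀ x, HasSum (fun n => E n x) (S x)) : ¬ IsFiniteProj A S := by
  intro hfin
  have ho' : ∀ m n, m ≠ n → E (m + 1) * E (n + 1) = 0 := fun m n h => ho _ _ (by omega)
  obtain ⟨T, hT, hTs⟩ := exists_strong_sum_proj (fun n => hE (n + 1)) ho'
  -- The shift E_n ↦ E_{n+1} makes S equivalent to the subprojection omitting E_0.
  have hST : MvNEquiv A S T := .of_hasSum hE he ho ho' hS hTs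
  have hsub : IsSubproj A T S := isSubproj_of_hasSum hT hTs fun n => mul_of_hasSum hE ho hS (n + 1)
  have hTS := hfin.eq_of_equiv T hsub hST.symm
  have h1 : E 0 * T = 0 := mul_eq_zero_of_hasSum hTs fun n => ho _ _ (by omega)
  rw [hTS] at h1
  exact h0 (((hfin.isProj).mul_comm_eq (hE 0) (mul_of_hasSum hE ho hS 0)).symm.trans h1)

theorem exists_of_not_isFiniteProj {N : H →L[ℂ] H} (hN : IsProj A N) (h : ¬ IsFiniteProj A N) :
    ∃ Q, IsSubproj A Q N ∧ MvNEquiv A Q N ∧ Q ≠ N := by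
  by_contra! h'
  exact h ⟨hN, h'⟩

/-- An infinite projection contains a sequence of nonzero equivalent orthogonal projections. -/
theorem exists_sequence_of_not_isFiniteProj {N : H →L[ℂ] H} (hN : IsProj A N)
    (h : ¬ IsFiniteProj A N) : ∃ E : ℕ → H →L[ℂ] H, (∀ n, IsSubproj A (E n) N) ∧
      (∀ m n, m ≠ n → E m * E n = 0) ∧ (∀ m n, MvNEquiv A (E m) (E n)) ∧ ∀ n, E n ≠ 0 := by
  obtain ⟨N₁, hsub, ⟨V, hV, hV1, hV2⟩, hne⟩ := exists_of_not_isFiniteProj hN h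
  let W := star V
  have hW : W ∈ A := star_mem hV
  have hW1 : star W * W = N := by simpa [W] using hV2
  have hW2 : W * star W = N₁ := by simpa [W] using hV1
  have hWN : N₁ * W = W := by
    rw [← hW2, final_mul]
    rw [hW2]
    exact hsub.isProj.isStarProjection
  have hNW : N * W = W := by rw [← hWN, ← mul_assoc, hsub.mul_eq]
  -- D is the wandering projection of W, an isometry of N onto N₁; its translates under powers of W
  -- give the sequence.
  let D := N - N₁
  have hD : IsProj A D := hsub.sub hN
  have hD0 : D ≠ 0 := sub_ne_zero.2 hne.symm
  have hDW : D * W = 0 := by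
    simp only [D, sub_mul, hNW, hWN, sub_self]
  have hND : N * D = D := (hsub.sub_subproj hN).mul_eq
  let U : ℕ → H →L[ℂ] H := fun n => W ^ n * D
  have hU : ∀ n, U n ∈ A := fun n => mul_mem (pow_mem hW n) hD.mem
  have hNU : ∀ n, N * U n = U n := by
    intro n
    cases n with
    | zero => simp [U, hND]
    | succ n => simp only [U, pow_succ']; rw [mul_assoc, ← mul_assoc, hNW]
  have hUs : ∀ n, U (n + 1) = W * U n := fun n => by simp only [U, pow_succ', mul_assoc]
  -- W*W = N acts trivially on each U_n, so common factors W cancel; a leftover W on the right is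
  -- killed by DW = 0.
  have hUU : ∀ n k, star (U n) * U (n + k) = if k = 0 then D else 0 := by
    intro n
    induction n with
    | zero =>
      intro k
      rcases k with _ | k
      · simp [U, hD.star_eq, hD.mul_self]
      · rw [zero_add, hUs, ← mul_assoc]
        simp [U, hD.star_eq, hDW]
    | succ n ih =>
      intro k
      rw [← ih k, add_right_comm, hUs, hUs, star_mul, mul_assoc, ← mul_assoc (star W), hW1, hNU]
  have hUD : ∀ n, star (U n) * U n = D := fun n => by simpa using hUU n 0
  have hUo : ∀ m n, m ≠ n → star (U m) * U n = 0 := by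
    have key : ∀ m n, m < n → star (U m) * U n = 0 := by
      intro m n hmn
      obtain ⟨k, rfl⟩ := Nat.exists_eq_add_of_lt hmn
      simpa [add_assoc] using hUU m (k + 1)
    intro m n hmn
    rcases lt_or_gt_of_ne hmn with h1 | h1
    · exact key m n h1
    · simpa using congr(star $(key n m h1))
  have hDE : ∀ n, MvNEquiv A D (U n * star (U n)) := fun n => ⟨U n, hU n, hUD n, rfl⟩
  refine ⟨fun n => U n * star (U n), fun n => ⟨(hDE n).isProj hD, by rw [← mul_assoc, hNU]⟩,
    fun m n hmn => ?_, fun m n => (hDE m).symm.trans (hDE n) ((hDE m).isProj hD), fun n hn => ?_⟩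
  · calc _ = U m * (star (U m) * U n) * star (U n) := by noncomm_ring
      _ = 0 := by rw [hUo m n hmn, mul_zero, zero_mul]
  · exact hD0 ((hn ▸ hDE n : MvNEquiv A D 0)).eq_zero

/-- An infinite projection is the sum of two infinite projections. -/
theorem exists_halving {N : H →L[ℂ] H} (hN : IsProj A N) (h : ¬ IsFiniteProj A N) :
    ∃ G, IsSubproj A G N ∧ ¬ IsFiniteProj A G ∧ ¬ IsFiniteProj A (N - G) := by
  obtain ⟨E, hE, ho, he, h0⟩ := exists_sequence_of_not_isFiniteProj hN h
  -- The even and the odd members each sum to an infinite projection.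
  have ho1 : ∀ m n, m ≠ n → E (2 * m) * E (2 * n) = 0 := fun m n h => ho _ _ (by omega)
  have ho2 : ∀ m n, m ≠ n → E (2 * m + 1) * E (2 * n + 1) = 0 := fun m n h => ho _ _ (by omega)
  obtain ⟨G, hG, hGs⟩ := exists_strong_sum_proj (fun n => (hE (2 * n)).isProj) ho1
  obtain ⟨G', hG', hGs'⟩ := exists_strong_sum_proj (fun n => (hE (2 * n + 1)).isProj) ho2
  have h1 : IsSubproj A G N := isSubproj_of_hasSum hG hGs fun n => (hE _).mul_eq
  refine ⟨G, h1, not_isFiniteProj_of_hasSum (fun n => (hE (2 * n)).isProj) ho1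
    (fun n => he _ _) (h0 _) hGs, fun hfin => ?_⟩
  refine not_isFiniteProj_of_hasSum (fun n => (hE (2 * n + 1)).isProj) ho2
    (fun n => he _ _) (h0 _) hGs' (hfin.of_subproj (isSubproj_of_hasSum hG' hGs' fun n => ?_))
  have h2 : G * E (2 * n + 1) = 0 :=
    (hE (2 * n + 1)).isProj.mul_comm_zero hG
      (mul_eq_zero_of_hasSum hGs fun m => ho (2 * n + 1) (2 * m) (by omega))
  rw [sub_mul, h2, sub_zero, (hE _).mul_eq]

/-- Kaplansky's parallelogram law: `G - G ∧ F^⊥ ∼ F - F ∧ G^⊥`. -/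
theorem exists_parallelogram {G F : H →L[ℂ] H} (hG : IsProj A G) (hF : IsProj A F) :
    ∃ M M', IsSubproj A M G ∧ IsSubproj A M' F ∧ (∀ x, M x = x ↔ G x = x ∧ F x = 0) ∧
      (∀ x, M' x = x ↔ F x = x ∧ G x = 0) ∧ MvNEquiv A (G - M) (F - M') := by
  obtain ⟨V, hV, hVp, hk, hk'⟩ := exists_polar (mul_mem hF.mem hG.mem)
  -- With V the polar part of FG, the kernel of V within G consists of the vectors of G killed by F.
  -- The same argument for V* and GF treats the final projection.
  have main : ∀ {F G V : H →L[ℂ] H}, IsProj A F → IsProj A G → V ∈ A →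
      IsStarProjection (star V * V) → (∀ x, V x = 0 ↔ F (G x) = 0) →
      IsSubproj A (star V * V) G ∧ ∀ x, (G - star V * V) x = x ↔ G x = x ∧ F x = 0 := by
    intro F G V hF hG hV hVp hk
    have hp : IsProj A (star V * V) := ⟨mul_mem (star_mem hV) hV, hVp⟩
    have hVG : V * G = V := by
      rw [← sub_eq_zero, ← neg_eq_zero, neg_sub]
      ext x
      change V x - V (G x) = 0
      rw [← map_sub, hk, map_sub, hG.apply_apply, sub_self, map_zero]
    have hs : IsSubproj A (star V * V) G :=
      ⟨hp, by
        have : G * star V = star V := by simpa [hG.star_eq] using congr(star $hVG)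
        rw [← mul_assoc, this]⟩
    refine ⟨hs, fun x => ?_⟩
    have hV0 : (star V * V) x = 0 ↔ V x = 0 := by
      rw [← norm_eq_zero, ← norm_apply_eq_initial V hVp, norm_eq_zero]
    constructor
    · intro hx
      have h1 : G x = x := by
        rw [← hx]
        exact congr($((hs.sub_subproj hG).mul_eq) x)
      refine ⟨h1, ?_⟩
      have h2 : (star V * V) x = 0 := by
        have : G x - (star V * V) x = x := hx
        rwa [h1, sub_eq_self] at this
      have h3 := (hk x).1 (hV0.1 h2)
      rwa [h1] at h3
    · rintro ⟨h1, h2⟩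
      rw [sub_apply, h1, hV0.2 ((hk x).2 (by rw [h1, h2])), sub_zero]
  obtain ⟨a1, a2⟩ := main hF hG hV hVp hk
  obtain ⟨b1, b2⟩ := main (V := star V) hG hF (star_mem hV)
    (by simpa using isStarProjection_final hVp) (fun x => by
      rw [hk', star_mul, hF.star_eq, hG.star_eq]; rfl)
  rw [star_star] at b1 b2
  refine ⟨_, _, a1.sub_subproj hG, b1.sub_subproj hF, a2, b2, V, hV, ?_, ?_⟩ <;> abel

/-- In a factor, the sum of two orthogonal finite projections is finite. -/
theorem IsFactor.isFiniteProj_add (hA : IsFactor A) {E F : H →L[ℂ] H} (hE : IsFiniteProj A E)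
    (hF : IsFiniteProj A F) (h : E * F = 0) : IsFiniteProj A (E + F) := by
  by_contra hN
  have hNp := hE.isProj.add hF.isProj h
  have h' := hE.isProj.mul_comm_zero hF.isProj h
  obtain ⟨G, hG, hG1, hG2⟩ := exists_halving hNp hN
  obtain ⟨M, M', hM, hM', mM, mM', hMM⟩ := exists_parallelogram hG.isProj hF.isProj
  obtain ⟨L', L, hL', hL, mL', mL, hLL⟩ := exists_parallelogram (hG.sub hNp) hE.isProj
  have hEE := hE.isProj.apply_apply
  have hFF := hF.isProj.apply_apply
  have hEF : ∀ x, E (F x) = 0 := fun x => congr($h x)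
  have hFE : ∀ x, F (E x) = 0 := fun x => congr($h' x)
  have hNG : ∀ x, E (G x) + F (G x) = G x := fun x => congr($hG.mul_eq x)
  have hGN : ∀ x, G (E x) + G (F x) = G x := fun x => by
    rw [← map_add]; exact congr($(hG.mul_eq' hNp) x)
  have hGG := hG.isProj.apply_apply
  -- With N = E + F, the defects of the pairs (G, F) and (N - G, E) coincide crosswise: inside N,
  -- being orthogonal to E means lying in F, and being orthogonal to N - G means lying in G.
  have e1 : L' = M' := by
    refine hL'.isProj.ext hM'.isProj fun x => ?_
    rw [mL', mM']
    simp only [sub_apply, add_apply]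
    constructor
    · rintro ⟨h1, h2⟩
      rw [h2, zero_add] at h1
      have h3 : G x = 0 := by
        have := congrArg G h1
        rw [map_sub, hGG] at this
        have h4 := hGN x
        rw [h2, map_zero, zero_add] at h4
        rw [h4, sub_self] at this
        exact this.symm
      rw [h3, sub_zero] at h1
      exact ⟨h1, h3⟩
    · rintro ⟨h1, h2⟩
      have h3 : E x = 0 := by rw [← h1, hEF]
      rw [h1, h2, h3]
      simp
  have e2 : L = M := by
    refine hL.isProj.ext hM.isProj fun x => ?_
    rw [mL, mM]
    simp only [sub_apply, add_apply]
    constructor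
    · rintro ⟨h1, h2⟩
      have h3 : F x = 0 := by rw [← h1, hFE]
      rw [h1, h3, add_zero, sub_eq_zero] at h2
      exact ⟨h2.symm, h3⟩
    · rintro ⟨h1, h2⟩
      have h3 := hNG x
      rw [h1, h2, add_zero] at h3
      rw [h1, h2, h3]
      simp
  subst e1 e2
  -- The parallelogram laws give G - M ∼ F - M' and (N - G) - M' ∼ E - M. If M is subequivalent to
  -- M', then G is subequivalent to F; in the other case N - G is subequivalent to E. Either way an
  -- infinite half would be finite.
  rcases hA.comparison hM.isProj hM'.isProj with ⟨R, hR, hMR⟩ | ⟨R, hR, hMR⟩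
  · have h1 := hMM.add hMR (hM.sub hG.isProj) hM.isProj
      (hM.isProj.mul_comm_zero (hM.sub hG.isProj) (hM.mul_sub_eq_zero hG.isProj)) (by
        rw [← hR.mul_eq, ← mul_assoc, hM'.isProj.mul_comm_zero (hM'.sub hF.isProj)
          (hM'.mul_sub_eq_zero hF.isProj), zero_mul])
    rw [sub_add_cancel] at h1
    refine hG1 ((hF.of_subproj ⟨h1.isProj hG.isProj, ?_⟩).of_equiv h1.symm)
    rw [mul_add, (hM'.sub_subproj hF.isProj).mul_eq, (hR.trans hM').mul_eq]
  · have hGp := hG.sub hNp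
    have h1 := hLL.add hMR.symm (hL'.sub hGp) hL'.isProj
      (hL'.isProj.mul_comm_zero (hL'.sub hGp) (hL'.mul_sub_eq_zero hGp)) (by
        rw [← hR.mul_eq, ← mul_assoc, hL.isProj.mul_comm_zero (hL.sub hE.isProj)
          (hL.mul_sub_eq_zero hE.isProj), zero_mul])
    rw [sub_add_cancel] at h1
    refine hG2 ((hE.of_subproj ⟨h1.isProj hGp, ?_⟩).of_equiv h1.symm)
    rw [mul_add, (hL.sub_subproj hE.isProj).mul_eq, (hR.trans hL).mul_eq]

theorem isFiniteProj_zero : IsFiniteProj A (0 : H →L[ℂ] H) :=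
  ⟨isProj_zero, fun Q hQ _ => by rw [← hQ.mul_eq, zero_mul]⟩

theorem IsFactor.isFiniteProj_sum (hA : IsFactor A) {I : Type*} {P : I → H →L[ℂ] H}
    (hP : ∀ i, IsFiniteProj A (P i)) (ho : ∀ i j, i ≠ j → P i * P j = 0) (s : Finset I) :
    IsFiniteProj A (∑ i ∈ s, P i) := by
  classical
  induction s using Finset.induction_on with
  | empty => simpa using isFiniteProj_zero
  | insert i s hi ih =>
    rw [Finset.sum_insert hi]
    refine hA.isFiniteProj_add (hP i) ih ?_
    rw [Finset.mul_sum]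
    exact Finset.sum_eq_zero fun j hj => ho i j fun h => hi (h ▸ hj)

end FiniteSum

/-! ### Decomposition of the identity into copies of a finite projection. -/

section Decomposition

variable {H : Type u} [NormedAddCommGroup H] [InnerProductSpace ℂ H] [CompleteSpace H]
  {A : VonNeumannAlgebra H}

/-- A family of nonzero mutually orthogonal projections on a separable space is countable. -/
theorem countable_of_orthogonal {I : Type*} {P : I → H →L[ℂ] H}
    (hP : ∀ i, IsStarProjection (P i)) (ho : ∀ i j, i ≠ j → P i * P j = 0) (h0 : ∀ i, P i ≠ 0)
    [TopologicalSpace.SeparableSpace H] : Countable I := by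
  have hx : ∀ i, ∃ x : H, P i x = x ∧ ‖x‖ = 1 := by
    intro i
    obtain ⟨x, hx⟩ : ∃ x, P i x ≠ 0 := by
      by_contra! h
      exact h0 i (ContinuousLinearMap.ext h)
    refine ⟨((‖P i x‖ : ℂ)⁻¹) • P i x, ?_, ?_⟩
    · rw [map_smul]
      congr 1
      exact congr($((hP i).isIdempotentElem.eq) x)
    · rw [norm_smul, norm_inv, Complex.norm_real, norm_norm, inv_mul_cancel₀ (norm_ne_zero_iff.2 hx)]
  choose x hx1 hx2 using hx
  -- Orthogonal unit vectors are √2 apart, so balls of radius 1/2 around them are disjoint.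
  refine Pairwise.countable_of_isOpen_disjoint (s := fun i => Metric.ball (x i) (1 / 2)) ?_
    (fun i => Metric.isOpen_ball) (fun i => ⟨x i, Metric.mem_ball_self (by norm_num)⟩)
  intro i j hij
  refine Metric.ball_disjoint_ball ?_
  have h1 : inner ℂ (x i) (x j) = 0 := inner_projSpace_eq_zero (hP i) (ho i j hij)
    (mem_projSpace.2 (hx1 i)) (mem_projSpace.2 (hx1 j))
  have h2 := norm_sub_sq (𝕜 := ℂ) (x i) (x j)
  rw [h1, hx2, hx2, map_zero] at h2
  rw [dist_eq_norm]
  nlinarith [norm_nonneg (x i - x j)]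

/-- A maximal family of mutually orthogonal copies of a nonzero projection `P₀`, orthogonal to
`P₀`, leaves a remainder equivalent to a subprojection of `P₀`. -/
theorem IsFactor.exists_maximal_family (hA : IsFactor A) {P₀ : H →L[ℂ] H} (hP₀ : IsProj A P₀)
    (h0 : P₀ ≠ 0) : ∃ (J : Type u) (P : J → H →L[ℂ] H) (R R' S : H →L[ℂ] H),
      (∀ j, IsProj A (P j)) ∧ (∀ j, MvNEquiv A P₀ (P j)) ∧ (∀ j, P₀ * P j = 0) ∧
      (∀ i j, i ≠ j → P i * P j = 0) ∧ (∀ x, HasSum (fun j => P j x) (S x)) ∧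
      P₀ + S + R = 1 ∧ IsProj A R ∧ IsSubproj A R' P₀ ∧ MvNEquiv A R' R ∧ P₀ * R = 0 ∧
      ∀ j, P j * R = 0 := by
  let F : Set (Set (H →L[ℂ] H)) := {s | (∀ P ∈ s, IsProj A P ∧ MvNEquiv A P₀ P ∧ P₀ * P = 0) ∧
    ∀ P ∈ s, ∀ Q ∈ s, P ≠ Q → P * Q = 0}
  obtain ⟨s, hs⟩ : ∃ s, Maximal (· ∈ F) s := by
    refine zorn_subset F fun c hcF hc => ⟨⋃₀ c, ⟨?_, ?_⟩, fun s hs => Set.subset_sUnion_of_mem hs⟩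
    · rintro V ⟨t, ht, hV⟩
      exact (hcF ht).1 V hV
    · rintro V ⟨t, ht, hV⟩ W ⟨t', ht', hW⟩ hne
      rcases hc.total ht ht' with h | h
      · exact (hcF ht').2 V (h hV) W hW hne
      · exact (hcF ht).2 V hV W (h hW) hne
  have hsF : s ∈ F := hs.prop
  have hp : ∀ P : s, IsProj A (P : H →L[ℂ] H) := fun P => (hsF.1 P P.2).1
  have ho : ∀ P Q : s, P ≠ Q → (P : H →L[ℂ] H) * (Q : H →L[ℂ] H) = 0 := fun P Q h =>
    hsF.2 P P.2 Q Q.2 (Subtype.coe_ne_coe.2 h)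
  obtain ⟨S, hS, hSs⟩ := exists_strong_sum_proj hp ho
  have hPS : P₀ * S = 0 := mul_eq_zero_of_hasSum hSs fun P => (hsF.1 P P.2).2.2
  have hPSp := hP₀.add hS hPS
  have hsub1 : IsSubproj A (P₀ + S) 1 := ⟨hPSp, one_mul _⟩
  have hR := hsub1.sub isProj_one
  have hPR : P₀ * (1 - (P₀ + S)) = 0 := by
    rw [mul_sub, mul_add, hPS, hP₀.mul_self, mul_one, add_zero, sub_self]
  have hsR : ∀ P ∈ s, P * (1 - (P₀ + S)) = 0 := by
    intro P hP
    rw [mul_sub, mul_add, hP₀.mul_comm_zero (hp ⟨P, hP⟩) (hsF.1 P hP).2.2,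
      hS.mul_comm_eq (hp ⟨P, hP⟩) (mul_of_hasSum hp ho hSs ⟨P, hP⟩), zero_add, mul_one, sub_self]
  have hfin : ∃ R', IsSubproj A R' P₀ ∧ MvNEquiv A R' (1 - (P₀ + S)) := by
    rcases hA.comparison hP₀ hR with ⟨Q, hQ, hPQ⟩ | h
    -- A copy Q of P₀ inside the remainder could be added to the family; maximality puts it in the
    -- family, hence orthogonal to the remainder and zero.
    · exfalso
      have hQs : Q ∈ s := by
        have hz : ∀ P, P * (1 - (P₀ + S)) = 0 → P * Q = 0 := fun P h => by
          rw [← hQ.mul_eq, ← mul_assoc, h, zero_mul]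
        refine hs.le_of_ge (y := insert Q s) ⟨?_, ?_⟩ (Set.subset_insert Q s) (Set.mem_insert Q s)
        · rintro P (rfl | hP)
          · exact ⟨hQ.isProj, hPQ, hz _ hPR⟩
          · exact hsF.1 P hP
        · rintro P (rfl | hP) P' (rfl | hP') hne
          · exact absurd rfl hne
          · exact (hp ⟨P', hP'⟩).mul_comm_zero hQ.isProj (hz _ (hsR P' hP'))
          · exact hz _ (hsR P hP)
          · exact hsF.2 P hP P' hP' hne
      have hQ0 : Q = 0 := by
        rw [← hQ.isProj.mul_self]
        conv_lhs => enter [2]; rw [← hQ.mul_eq]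
        rw [← mul_assoc, hsR Q hQs, zero_mul]
      rw [hQ0] at hPQ
      exact h0 hPQ.eq_zero
    · exact h
  obtain ⟨R', hR', hRR⟩ := hfin
  exact ⟨s, fun P => P, 1 - (P₀ + S), R', S, hp, fun P => (hsF.1 P P.2).2.1,
    fun P => (hsF.1 P P.2).2.2, ho, hSs, add_sub_cancel _ _, hR, hR', hRR, hPR,
    fun P => hsR P P.2⟩

/-- The hotel shift: it makes room for the one extra piece R among the indices J. -/
theorem exists_equiv_option (J : Type u) [Infinite J] : Nonempty (Option J ≃ J) := by
  rw [← Cardinal.eq, Cardinal.mk_option]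
  exact Cardinal.add_one_eq (Cardinal.aleph0_le_mk J)

/-- In a factor with an infinite projection, every nonzero finite projection `P₀` is a member of
an infinite decomposition of `1` into copies of `P₀`. -/
theorem IsFactor.exists_decomposition (hA : IsFactor A) (hinf : ¬ IsFiniteProj A (1 : H →L[ℂ] H))
    {P₀ : H →L[ℂ] H} (hP₀ : IsFiniteProj A P₀) (h0 : P₀ ≠ 0) :
    ∃ (I : Type u) (i₀ : I) (P : I → H →L[ℂ] H), Infinite I ∧
      (TopologicalSpace.SeparableSpace H → Countable I) ∧
      IsFiniteDecomposition A P₀ P ∧ P i₀ = P₀ := by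
  obtain ⟨J, P, R, R', S, hP, hPe, hP₀P, hPo, hS, h1, hR, hR', hRR, hP₀R, hPR⟩ :=
    hA.exists_maximal_family hP₀.isProj h0
  have hPf : ∀ j, IsFiniteProj A (P j) := fun j => hP₀.of_equiv (hPe j)
  have hP₀p := hP₀.isProj
  have hRP₀ := hP₀p.mul_comm_zero hR hP₀R
  have hRP := fun j => (hP j).mul_comm_zero hR (hPR j)
  have hPP₀ := fun j => hP₀p.mul_comm_zero (hP j) (hP₀P j)
  have hJ : Infinite J := by
    by_contra hJ
    rw [not_infinite_iff_finite] at hJ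
    have := Fintype.ofFinite J
    have hSeq : S = ∑ j, P j := by
      ext x
      rw [sum_apply]
      exact (hS x).unique (hasSum_fintype _)
    have hSf := hSeq ▸ hA.isFiniteProj_sum hPf hPo Finset.univ
    have hP₀S : P₀ * S = 0 := mul_eq_zero_of_hasSum hS hP₀P
    have hRS : R * S = 0 := mul_eq_zero_of_hasSum hS hRP
    refine hinf (h1 ▸ hA.isFiniteProj_add (hA.isFiniteProj_add hP₀ hSf hP₀S)
      ((hP₀.of_subproj hR').of_equiv hRR) ?_)
    rw [add_mul, hP₀R, hR.mul_comm_zero hSf.isProj hRS, add_zero]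
  obtain ⟨e⟩ := exists_equiv_option J
  choose R₁ hR₁ hRR₁ hRR₂ _ using fun j => (hPe j).exists_subproj hP₀p hR'
  -- The copies of R': the remainder R at `none`, and R₁ j inside P_j at `some j`. D_j is the rest
  -- of P_j, a copy of P₀ - R'.
  let X : Option J → H →L[ℂ] H := fun o => o.elim R R₁
  let D : J → H →L[ℂ] H := fun j => P j - R₁ j
  have hX : ∀ o, IsProj A (X o) := by
    rintro (_ | j)
    · exact hR
    · exact (hR₁ j).isProj
  have hD : ∀ j, IsSubproj A (D j) (P j) := fun j => (hR₁ j).sub_subproj (hP j)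
  have cross : ∀ {B C Q Q' : H →L[ℂ] H}, Q * Q' = 0 → B * Q = B → Q' * C = C → B * C = 0 := by
    intro B C Q Q' h h2 h3
    calc B * C = B * (Q * Q') * C := by
          conv_lhs => rw [← h2, ← h3]
          noncomm_ring
      _ = 0 := by rw [h, mul_zero, zero_mul]
  have hXo : ∀ o o', o ≠ o' → X o * X o' = 0 := by
    rintro (_ | j) (_ | k) hne
    · exact absurd rfl hne
    · exact cross (hRP k) hR.mul_self (hR₁ k).mul_eq
    · exact cross (hPR j) ((hR₁ j).mul_eq' (hP j)) hR.mul_self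
    · exact cross (hPo j k fun h => hne (congrArg some h)) ((hR₁ j).mul_eq' (hP j)) (hR₁ k).mul_eq
  have hDo : ∀ i j, i ≠ j → D i * D j = 0 := fun i j hij =>
    cross (hPo i j hij) ((hD i).mul_eq' (hP i)) (hD j).mul_eq
  have hXD : ∀ o j, X o * D j = 0 := by
    rintro (_ | k) j
    · exact cross (hRP j) hR.mul_self (hD j).mul_eq
    · by_cases hkj : k = j
      · subst hkj
        exact (hR₁ k).mul_sub_eq_zero (hP k)
      · exact cross (hPo k j hkj) ((hR₁ k).mul_eq' (hP k)) (hD j).mul_eq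
  have hDX : ∀ o j, D j * X o = 0 := fun o j => (hX o).mul_comm_zero (hD j).isProj (hXD o j)
  have hP₀X : ∀ o, P₀ * X o = 0 := by
    rintro (_ | k)
    · exact hP₀R
    · exact cross (hP₀P k) hP₀p.mul_self (hR₁ k).mul_eq
  have hP₀D : ∀ j, P₀ * D j = 0 := fun j => cross (hP₀P j) hP₀p.mul_self (hD j).mul_eq
  have hR'X : ∀ o, MvNEquiv A R' (X o) := by
    rintro (_ | k)
    · exact hRR
    · exact hRR₁ k
  -- The D_j stay in place while the copies of R' move along e; each new sum is again a copy of P₀.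
  -- The index `none` is kept for P₀ itself.
  let Q : Option J → H →L[ℂ] H := fun o => o.elim P₀ fun j => X (e.symm j) + D j
  have hQe : ∀ o, MvNEquiv A P₀ (Q o) := by
    rintro (_ | j)
    · exact .refl hP₀p
    · have := (hR'X (e.symm j)).add (hRR₂ j) hR'.isProj (hR'.sub hP₀p)
        (hR'.mul_sub_eq_zero hP₀p) (hXD _ _)
      rwa [add_sub_cancel] at this
  have hQp : ∀ o, IsProj A (Q o) := fun o => (hQe o).isProj hP₀p
  have hP₀Q : ∀ j, P₀ * Q (some j) = 0 := fun j => by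
    change P₀ * (X (e.symm j) + D j) = 0
    rw [mul_add, hP₀X, hP₀D, add_zero]
  have hQo : ∀ o o', o ≠ o' → Q o * Q o' = 0 := by
    rintro (_ | j) (_ | k) hne
    · exact absurd rfl hne
    · exact hP₀Q k
    · exact hP₀p.mul_comm_zero (hQp _) (hP₀Q j)
    · have hjk : j ≠ k := fun h => hne (congrArg some h)
      change (X (e.symm j) + D j) * (X (e.symm k) + D k) = 0
      rw [add_mul, mul_add, mul_add, hXo _ _ (e.symm.injective.ne hjk), hXD, hDX, hDo j k hjk]
      simp
  obtain ⟨T, hT, hTs⟩ := exists_strong_sum_proj hQp hQo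
  have hTQ := mul_of_hasSum hQp hQo hTs
  -- Every X o and every D_j lies under some Q, so T dominates R, all P_j and P₀, hence 1.
  have hTX : ∀ o, T * X o = X o := by
    intro o
    have h2 : Q (some (e o)) * X o = X o := by
      change (X (e.symm (e o)) + D (e o)) * X o = X o
      rw [Equiv.symm_apply_apply, add_mul, (hX o).mul_self, hDX, add_zero]
    rw [← h2, ← mul_assoc, hTQ]
  have hTD : ∀ j, T * D j = D j := by
    intro j
    have h2 : Q (some j) * D j = D j := by
      change (X (e.symm j) + D j) * D j = D j
      rw [add_mul, (hD j).isProj.mul_self, hXD, zero_add]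
    rw [← h2, ← mul_assoc, hTQ]
  have hTP : ∀ j, T * P j = P j := by
    intro j
    have h2 : P j = X (some j) + D j := (add_sub_cancel (R₁ j) (P j)).symm
    rw [h2, mul_add, hTX, hTD]
  have hTS : (1 - T) * S = 0 := mul_eq_zero_of_hasSum hS fun j => by
    rw [sub_mul, one_mul, hTP, sub_self]
  have hT1 : T = 1 := by
    have h2 : T * S = S := by
      rw [sub_mul, one_mul, sub_eq_zero] at hTS
      exact hTS.symm
    have h3 : T * P₀ = P₀ := hTQ none
    have h4 : T * R = R := hTX none
    calc T = T * (P₀ + S + R) := by rw [h1, mul_one]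
      _ = 1 := by rw [mul_add, mul_add, h2, h3, h4, h1]
  refine ⟨Option J, none, Q, inferInstance, fun hsep => ?_,
    ⟨fun o => hP₀.of_equiv (hQe o), hQo, hQe, fun x => by simpa [hT1] using hTs x⟩, rfl⟩
  refine countable_of_orthogonal (fun o => (hQp o).isStarProjection) hQo fun o ho => ?_
  exact h0 (ho ▸ hQe o : MvNEquiv A P₀ 0).eq_zero

end Decomposition

/-! ### The Hilbert tensor product as a Hilbert sum. -/

section HilbertTensorLemmas

variable {H : Type u} [NormedAddCommGroup H] [InnerProductSpace ℂ H]
  {K : Type v} [NormedAddCommGroup K] [InnerProductSpace ℂ K]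

theorem inner_htmul (x x' : H) (y y' : K) :
    inner ℂ (htmul x y) (htmul x' y') = inner ℂ x x' * inner ℂ y y' := by
  rw [htmul, htmul, UniformSpace.Completion.inner_coe, TensorProduct.inner_tmul]

theorem norm_htmul (x : H) (y : K) : ‖htmul x y‖ = ‖x‖ * ‖y‖ := by
  rw [htmul, UniformSpace.Completion.norm_coe, TensorProduct.norm_tmul]

/-- The elementary tensor as a bilinear map. -/
noncomputable def htmulBilin : H →ₗ[ℂ] K →ₗ[ℂ] HilbertTensor H K :=
  (TensorProduct.mk ℂ H K).compr₂ UniformSpace.Completion.toComplL.toLinearMap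

theorem htmulBilin_apply (x : H) (y : K) : htmulBilin x y = htmul x y := rfl

theorem continuous_htmul_right (x : H) : Continuous fun y : K => htmul x y :=
  (LinearMap.mkContinuous (htmulBilin x) ‖x‖ fun y => (norm_htmul x y).le).continuous

/-- Tensoring with a unit vector is an isometry. -/
noncomputable def htmulIsometry (y : K) (hy : ‖y‖ = 1) : H →ₗᵢ[ℂ] HilbertTensor H K where
  toLinearMap := htmulBilin.flip y
  norm_map' x := by
    change ‖htmul x y‖ = ‖x‖
    rw [norm_htmul, hy, mul_one]

/-- The slices H ⊗ ψ_i are orthogonal; their closed span contains every x ⊗ y, because y is a limit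
of combinations of the ψ_i, and hence everything. -/
theorem isHilbertSum_htmul [CompleteSpace H] {I : Type w} (ψ : HilbertBasis I ℂ K) :
    IsHilbertSum ℂ (fun _ : I => H) fun i => htmulIsometry (H := H) (ψ i) (ψ.orthonormal.1 i) := by
  refine .mk (fun i j hij x x' => ?_) ?_
  · change inner ℂ (htmul x (ψ i)) (htmul x' (ψ j)) = 0
    rw [inner_htmul, ψ.orthonormal.2 hij, mul_zero]
  · set N := (⨆ i, (htmulIsometry (H := H) (ψ i) (ψ.orthonormal.1 i)).toLinearMap.range)
      |>.topologicalClosure with hN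
    have hc : IsClosed (N : Set (HilbertTensor H K)) := Submodule.isClosed_topologicalClosure _
    have h1 : ∀ (x : H) (y : K), htmul x y ∈ N := by
      intro x y
      have h2 : Submodule.span ℂ (Set.range ψ) ≤ N.comap (htmulBilin x) := by
        rw [Submodule.span_le]
        rintro _ ⟨i, rfl⟩
        exact Submodule.le_topologicalClosure _
          (Submodule.mem_iSup_of_mem (p := fun i =>
            (htmulIsometry (H := H) (ψ i) (ψ.orthonormal.1 i)).toLinearMap.range) i ⟨x, rfl⟩)
      have h3 : y ∈ (Submodule.span ℂ (Set.range ψ)).topologicalClosure := by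
        rw [ψ.dense_span]; trivial
      exact Submodule.topologicalClosure_minimal _ h2
        (hc.preimage (continuous_htmul_right x)) h3
    intro z _
    refine UniformSpace.Completion.induction_on z hc fun t => ?_
    induction t with
    | zero => rw [UniformSpace.Completion.coe_zero]; exact N.zero_mem
    | tmul x y => exact h1 x y
    | add a b ha hb => rw [UniformSpace.Completion.coe_add]; exact N.add_mem ha hb

end HilbertTensorLemmas

/-! ### The spatial isomorphism and the matrix expansion. -/

section Spatial

theorem projSpace_apply {H : Type u} [NormedAddCommGroup H] [InnerProductSpace ℂ H]
    {P : H →L[ℂ] H} (x : projSpace P) : P x = x := mem_projSpace.1 x.2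

variable {H : Type u} [NormedAddCommGroup H] [InnerProductSpace ℂ H] [CompleteSpace H]

/-- A partial isometry restricted to its initial space. -/
noncomputable def initialIsometry (V P : H →L[ℂ] H) (hP : IsStarProjection P)
    (h : star V * V = P) : projSpace P →ₗᵢ[ℂ] H where
  toLinearMap := V.toLinearMap ∘ₗ (projSpace P).subtype
  norm_map' x := by
    change ‖V x‖ = ‖(x : H)‖
    rw [norm_apply_eq_initial V (h ▸ hP), h, projSpace_apply]

variable {A : VonNeumannAlgebra H} {I : Type v} {P₀ : H →L[ℂ] H} {V : I → H →L[ℂ] H}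

theorem star_apply_mem_projSpace {V : H →L[ℂ] H} (h : star V * V = P₀)
    (hP₀ : IsStarProjection P₀) (x : H) : star V x ∈ projSpace P₀ := by
  subst h
  rw [mem_projSpace]
  have h2 : star V * V * star V = star V := by
    simpa [mul_assoc] using congr(star $(mul_initial hP₀))
  exact congr($h2 x)

/-- The ranges V_i P₀H span a dense subspace, since x is the sum of the vectors V_i V_i* x. -/
theorem ext_of_hasSum {F : Type*} [NormedAddCommGroup F] [NormedSpace ℂ F]
    (hP₀ : IsStarProjection P₀) (hV : ∀ i, star (V i) * V i = P₀)
    (hs : ∀ x, HasSum (fun i => V i (star (V i) x)) x) {f g : H →L[ℂ] F}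
    (h : ∀ i (x : projSpace P₀), f (V i x) = g (V i x)) : f = g := by
  ext x
  refine ((hs x).mapL f).unique ?_
  have : ∀ i, f (V i (star (V i) x)) = g (V i (star (V i) x)) := fun i =>
    h i ⟨_, star_apply_mem_projSpace (hV i) hP₀ x⟩
  simp only [this]
  exact (hs x).mapL g

theorem isHilbertSum_initialIsometry (hP₀ : IsStarProjection P₀)
    (hV : ∀ i, star (V i) * V i = P₀) (ho : ∀ i j, i ≠ j → star (V i) * V j = 0)
    (hs : ∀ x, HasSum (fun i => V i (star (V i) x)) x) :
    IsHilbertSum ℂ (fun _ : I => projSpace P₀) fun i => initialIsometry (V i) P₀ hP₀ (hV i) := by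
  refine .mk (fun i j hij x x' => ?_) ?_
  · change inner ℂ (V i x) (V j x') = 0
    rw [← ContinuousLinearMap.adjoint_inner_right, ← ContinuousLinearMap.star_eq_adjoint]
    have : star (V i) (V j x') = 0 := congr($(ho i j hij) (x' : H))
    rw [this, inner_zero_right]
  · intro x _
    refine Submodule.isClosed_topologicalClosure _ |>.mem_of_tendsto (hs x)
      (Filter.Eventually.of_forall fun s => ?_)
    refine Submodule.le_topologicalClosure _ (Submodule.sum_mem _ fun i _ => ?_)
    exact Submodule.mem_iSup_of_mem (p := fun i =>
      (initialIsometry (V i) P₀ hP₀ (hV i)).toLinearMap.range) i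
      ⟨⟨_, star_apply_mem_projSpace (hV i) hP₀ x⟩, rfl⟩

/-- Rectangular truncations `P_F T P_G` converge strongly to `T`. -/
theorem tendsto_truncation {P : I → H →L[ℂ] H} (hP : ∀ i, IsStarProjection (P i))
    (ho : ∀ i j, i ≠ j → P i * P j = 0) (hs : ∀ x, HasSum (fun i => P i x) x) (T : H →L[ℂ] H)
    (x : H) : Filter.Tendsto
      (fun F : Finset I × Finset I => ∑ k ∈ F.1, ∑ i ∈ F.2, P k (T (P i x)))
      Filter.atTop (nhds (T x)) := by
  rw [← Filter.prod_atTop_atTop_eq]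
  have h1 : Filter.Tendsto (fun F : Finset I × Finset I => ∑ k ∈ F.1, P k (T x))
      (Filter.atTop ×ˢ Filter.atTop) (nhds (T x)) := (hs (T x)).comp Filter.tendsto_fst
  have h2 : Filter.Tendsto (fun F : Finset I × Finset I => ‖T (∑ i ∈ F.2, P i x) - T x‖)
      (Filter.atTop ×ˢ Filter.atTop) (nhds 0) := by
    have : Filter.Tendsto (fun s : Finset I => T (∑ i ∈ s, P i x)) Filter.atTop (nhds (T x)) :=
      (T.continuous.tendsto x).comp (hs x)
    exact (tendsto_iff_norm_sub_tendsto_zero.1 this).comp Filter.tendsto_snd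
  -- As ‖P_F‖ ≤ 1, the error from truncating by G is controlled uniformly in F, so F and G may grow
  -- independently.
  have h3 : Filter.Tendsto (fun F : Finset I × Finset I =>
      (∑ k ∈ F.1, P k) (T (∑ i ∈ F.2, P i x) - T x)) (Filter.atTop ×ˢ Filter.atTop) (nhds 0) :=
    squeeze_zero_norm (fun F =>
      norm_apply_le_of_isStarProjection (isStarProjection_sum hP ho F.1) _) h2
  have h4 := h3.add h1
  rw [zero_add] at h4
  refine h4.congr fun F => ?_
  rw [map_sub, sum_apply, sum_apply, sub_add_cancel]
  refine Finset.sum_congr rfl fun k _ => ?_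
  rw [map_sum, map_sum]

/-- Matrix units of partial isometries with common initial projection `P₀` and with final
projections summing to `1` identify `A` with `P₀ A P₀ ⊗ B(K)`. -/
theorem exists_spatial_tensor (hP₀ : IsProj A P₀) (hVA : ∀ i, V i ∈ A)
    (hV : ∀ i, star (V i) * V i = P₀) (ho : ∀ i j, i ≠ j → star (V i) * V j = 0)
    (hs : ∀ x, HasSum (fun i => V i (star (V i) x)) x)
    (K : Type w) [NormedAddCommGroup K] [InnerProductSpace ℂ K] [CompleteSpace K]
    (ψ : HilbertBasis I ℂ K) :
    ∃ U : H ≃ₗᵢ[ℂ] HilbertTensor (projSpace P₀) K,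
      (∀ (i : I) (x : projSpace P₀), U (V i x) = htmul x (ψ i)) ∧
      U.conjStarAlgEquiv '' (A : Set (H →L[ℂ] H)) =
        vnTensor (corner A P₀ hP₀) (boundedOps K) ∧
      ∀ T ∈ A, ∀ ξ : HilbertTensor (projSpace P₀) K,
        Filter.Tendsto
          (fun F : Finset I × Finset I => ∑ k ∈ F.1, ∑ i ∈ F.2,
            opTensor (compress P₀ (star (V k) * T * V i)) (matrixUnit ψ k i) ξ)
          Filter.atTop (nhds (U.conjStarAlgEquiv T ξ)) := by
  classical
  have hp := hP₀.isStarProjection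
  have hsum1 := isHilbertSum_initialIsometry hp hV ho hs
  have hsum2 := isHilbertSum_htmul (H := projSpace P₀) ψ
  -- Both spaces are identified with the ℓ² sum of I copies of P₀H.
  let U : H ≃ₗᵢ[ℂ] HilbertTensor (projSpace P₀) K :=
    hsum1.linearIsometryEquiv.trans hsum2.linearIsometryEquiv.symm
  have hU : ∀ (i : I) (x : projSpace P₀), U (V i x) = htmul x (ψ i) := by
    intro i x
    change hsum2.linearIsometryEquiv.symm (hsum1.linearIsometryEquiv (V i x)) = _
    have : hsum1.linearIsometryEquiv (V i x) = lp.single 2 i x := by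
      rw [← LinearIsometryEquiv.eq_symm_apply, hsum1.linearIsometryEquiv_symm_apply_single]
      rfl
    rw [this, hsum2.linearIsometryEquiv_symm_apply_single]
    rfl
  have hφ : ∀ (T : H →L[ℂ] H) (z : H), U.conjStarAlgEquiv T (U z) = U (T z) := by
    intro T z
    simp
  clear_value U
  have ext : ∀ {X Y : HilbertTensor (projSpace P₀) K →L[ℂ] HilbertTensor (projSpace P₀) K},
      (∀ (x : projSpace P₀) i, X (htmul x (ψ i)) = Y (htmul x (ψ i))) → X = Y := by
    intro X Y h
    have h1 : X ∘L (U : H →L[ℂ] HilbertTensor (projSpace P₀) K) = Y ∘L U :=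
      ext_of_hasSum hp hV hs fun i x => by
        change X (U (V i x)) = Y (U (V i x))
        rw [hU, h]
    ext1 ξ
    obtain ⟨z, rfl⟩ := U.surjective ξ
    exact congr($h1 z)
  -- The matrix term at (k, i) is the image of the block P_k T P_i.
  have hentry : ∀ (T : H →L[ℂ] H) (k i : I),
      opTensor (compress P₀ (star (V k) * T * V i)) (matrixUnit ψ k i) =
        U.conjStarAlgEquiv (V k * star (V k) * T * (V i * star (V i))) := by
    intro T k i
    refine ext fun x j => ?_
    rw [opTensor_htmul, ← hU, hφ]
    by_cases hij : i = j
    · subst hij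
      have h1 : matrixUnit ψ k i (ψ i) = ψ k := by
        simp [matrixUnit, ψ.orthonormal.1 i]
      have h2 : star (V i) (V i x) = x := by
        exact congr($(hV i) (x : H)).trans (projSpace_apply x)
      rw [h1, ← hU, coe_compress_apply hp]
      congr 1
      change V k (P₀ (star (V k) (T (V i x)))) = V k (star (V k) (T (V i (star (V i) (V i x)))))
      rw [h2, mem_projSpace.1 (star_apply_mem_projSpace (hV k) hp _)]
    · have h1 : matrixUnit ψ k i (ψ j) = 0 := by
        simp [matrixUnit, ψ.orthonormal.2 hij]
      have h2 : star (V i) (V j x) = 0 := congr($(ho i j hij) (x : H))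
      have h3 : (V k * star (V k) * T * (V i * star (V i))) (V j x) = 0 := by
        change (V k * star (V k) * T) (V i (star (V i) (V j x))) = 0
        rw [h2, map_zero, map_zero]
      rw [h1, h3, map_zero, ← htmulBilin_apply, map_zero]
  have hlim : ∀ (T : H →L[ℂ] H) (ξ : HilbertTensor (projSpace P₀) K),
      Filter.Tendsto
        (fun F : Finset I × Finset I => ∑ k ∈ F.1, ∑ i ∈ F.2,
          opTensor (compress P₀ (star (V k) * T * V i)) (matrixUnit ψ k i) ξ)
        Filter.atTop (nhds (U.conjStarAlgEquiv T ξ)) := by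
    intro T ξ
    obtain ⟨z, rfl⟩ := U.surjective ξ
    have h1 := tendsto_truncation (P := fun i => V i * star (V i))
      (fun i => isStarProjection_final ((hV i).symm ▸ hp)) (fun i j hij => by
        calc _ = V i * (star (V i) * V j) * star (V j) := by noncomm_ring
          _ = 0 := by rw [ho i j hij, mul_zero, zero_mul]) hs T z
    have h2 := (U.continuous.tendsto _).comp h1
    rw [hφ]
    refine h2.congr fun F => ?_
    simp only [Function.comp_apply, map_sum]
    refine Finset.sum_congr rfl fun k _ => Finset.sum_congr rfl fun i _ => ?_
    rw [hentry, hφ]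
    rfl
  -- Since y commutes with each V_i, it acts in the same way on every copy of P₀H.
  have hcommutant : ∀ y ∈ A.commutant,
      U.conjStarAlgEquiv y = opTensor (compress P₀ y) 1 := by
    intro y hy
    refine ext fun x i => ?_
    rw [opTensor_htmul, ← hU, hφ, one_apply_eq_self, ← hU, coe_compress_apply hp,
      ← mem_iff_forall_commutant.1 hP₀.mem y hy, projSpace_apply,
      mem_iff_forall_commutant.1 (hVA i) y hy]
  refine ⟨U, hU, ?_, fun T _ => hlim T⟩
  rw [coe_vnTensor]
  refine Set.Subset.antisymm ?_ ?_
  -- Commutation with c passes from the truncations, which are sums of generators, to their strong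
  -- limit.
  · rintro _ ⟨T, hT, rfl⟩
    rw [Set.mem_centralizer_iff]
    intro c hc
    ext1 ξ
    have h1 := hlim T (c ξ)
    have h2 := (c.continuous.tendsto _).comp (hlim T ξ)
    refine tendsto_nhds_unique h2 (h1.congr fun F => ?_)
    simp only [Function.comp_apply, map_sum]
    refine Finset.sum_congr rfl fun k _ => Finset.sum_congr rfl fun i _ => ?_
    have h3 := Set.mem_centralizer_iff.1 hc (opTensor (compress P₀ (star (V k) * T * V i))
      (matrixUnit ψ k i)) ⟨_, ⟨_, mul_mem (mul_mem (star_mem (hVA k)) hT) (hVA i), rfl⟩, _,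
        trivial, rfl⟩
    exact congr($h3 ξ)
  -- It suffices that the preimage Y commutes with A'; the image of A' commutes with the generators,
  -- hence with X.
  · intro X hX
    obtain ⟨Y, rfl⟩ := U.conjStarAlgEquiv.surjective X
    refine ⟨Y, ?_, rfl⟩
    rw [SetLike.mem_coe, ← A.commutant_commutant, VonNeumannAlgebra.mem_commutant_iff]
    intro y hy
    have h1 : U.conjStarAlgEquiv y * U.conjStarAlgEquiv Y =
        U.conjStarAlgEquiv Y * U.conjStarAlgEquiv y := by
      refine Set.mem_centralizer_iff.1 hX _ ?_
      rw [Set.mem_centralizer_iff]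
      rintro _ ⟨_, ⟨T, hT, rfl⟩, b, -, rfl⟩
      rw [hcommutant y hy]
      refine ext fun x i => ?_
      change opTensor _ _ (opTensor _ _ _) = opTensor _ _ (opTensor _ _ _)
      simp only [opTensor_htmul, one_apply_eq_self]
      congr 1
      ext
      have e1 := mem_iff_forall_commutant.1 hP₀.mem y hy
      have e2 := mem_iff_forall_commutant.1 hT y hy
      simp only [coe_compress_apply hp]
      rw [← e1 x, projSpace_apply, ← e2, ← e1 (T x), e1, hP₀.apply_apply]
    refine ContinuousLinearMap.ext fun z => U.injective ?_
    have h2 : U.conjStarAlgEquiv y (U.conjStarAlgEquiv Y (U z)) =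
        U.conjStarAlgEquiv Y (U.conjStarAlgEquiv y (U z)) := congr($h1 (U z))
    have h3 := hφ y (Y z)
    have h4 := hφ Y (y z)
    rw [← hφ Y z] at h3
    rw [← hφ y z] at h4
    exact h3.symm.trans (h2.trans h4)

end Spatial

end VNA

theorem mainTheorem1 {H : Type u} [NormedAddCommGroup H] [InnerProductSpace ℂ H]
    [CompleteSpace H] (A : VonNeumannAlgebra H) (hA : VNA.IsTypeIIInftyFactor A) :
    (∃ P₀ : H →L[ℂ] H, VNA.IsFiniteProj A P₀ ∧ P₀ ≠ 0) ∧
    ∀ (P₀ : H →L[ℂ] H) (hP₀ : VNA.IsFiniteProj A P₀), P₀ ≠ 0 →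
      (∃ (I : Type u) (i₀ : I) (P : I → H →L[ℂ] H),
        Infinite I ∧ (TopologicalSpace.SeparableSpace H → Countable I) ∧
        VNA.IsFiniteDecomposition A P₀ P ∧ P i₀ = P₀) ∧
      ∀ (I : Type v) (P : I → H →L[ℂ] H), VNA.IsFiniteDecomposition A P₀ P →
      ∀ V : I → H →L[ℂ] H, (∀ i, V i ∈ A ∧ star (V i) * V i = P₀ ∧ V i * star (V i) = P i) →
      ∀ (K : Type w) [NormedAddCommGroup K] [InnerProductSpace ℂ K] [CompleteSpace K]
        (ψ : HilbertBasis I ℂ K),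
        ∃ U : H ≃ₗᵢ[ℂ] VNA.HilbertTensor (VNA.projSpace P₀) K,
          (∀ (i : I) (x : VNA.projSpace P₀), U (V i x) = VNA.htmul x (ψ i)) ∧
          U.conjStarAlgEquiv '' (A : Set (H →L[ℂ] H)) =
            VNA.vnTensor (VNA.corner A P₀ hP₀.isProj) (VNA.boundedOps K) ∧
          ∀ T ∈ A, ∀ ξ : VNA.HilbertTensor (VNA.projSpace P₀) K,
            Filter.Tendsto
              (fun F : Finset I × Finset I => ∑ k ∈ F.1, ∑ i ∈ F.2,
                VNA.opTensor (VNA.compress P₀ (star (V k) * T * V i)) (VNA.matrixUnit ψ k i) ξ)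
              Filter.atTop (nhds (U.conjStarAlgEquiv T ξ)) := by
  refine ⟨hA.exists_finite, fun P₀ hP₀ h0 => ⟨?_, ?_⟩⟩
  · obtain ⟨P, hP, Q, hQ, hne, hQP⟩ := hA.exists_infinite
    -- Were 1 finite, its infinite subprojection P would be finite too.
    exact hA.isFactor.exists_decomposition
      (fun h => hne ((h.of_subproj ⟨hP, one_mul P⟩).eq_of_equiv Q hQ hQP)) hP₀ h0
  · intro I P hP V hV K _ _ _ ψ
    have hi : ∀ i, IsStarProjection (star (V i) * V i) := fun i =>
      (hV i).2.1.symm ▸ hP₀.isProj.isStarProjection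
    refine VNA.exists_spatial_tensor hP₀.isProj (fun i => (hV i).1) (fun i => (hV i).2.1)
      (fun i j hij => VNA.star_mul_eq_zero_of_final (hi i) (hi j) ?_) (fun x => ?_) K ψ
    · rw [(hV i).2.2, (hV j).2.2, hP.orthogonal i j hij]
    · have : ∀ i, P i x = V i (star (V i) x) := fun i => by rw [← (hV i).2.2]; rfl
      simpa only [this] using hP.hasSum x
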